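/- Let $R$ be a principal ideal domain, $G$ an $R$-module and $0\to G\xrightarrow{\alpha}G'\xrightarrow{\beta}G''\to 0$ an injective resolution of $G$. For a cochain complex $C^*=\{C^n,\delta\}_{n\in\mathbb Z}$ of $R$-modules let $\operatorname{Hom}(C^*;\beta_\#)$ be the chain complex with $$\operatorname{Hom}(C^*;\beta_\#)_n=\operatorname{Hom}_R(C^n,G')\oplus\operatorname{Hom}_R(C^{n+1},G''),\qquad \partial(\varphi',\varphi'')=(\varphi'\circ\delta,\ \beta\circ\varphi'-\varphi''\circ\delta),$$ and let $\bar H_n(C^*;G)=H_n(\operatorname{Hom}(C^*;\beta_\#))$, a contravariant functor of $C^*$. A direct system $\mathbf C^*=\{C^*_\alpha\}$ of cochain complexes of $R$-modules (indexed by a directed set) is associated with a cochain complex $C^*$ through a homomorphism $\mathbf C^*\to C^*$ if for every $n\in\mathbb Z$ the induced homomorphism $\varinjlim H^n(C^*_\alpha)\to H^n(C^*)$ is an isomorphism. Write $\varprojlim^{(i)}$ for the $i$-th right derived functor of the inverse limit. **Lemma 5.** If $\mathbf C^*=\{C^*_\alpha\}$ is associated with $C^*$, then for every $n\in\mathbb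 Z$ there is an infinite exact sequence of $R$-modules $$\cdots\to\varprojlim{}^{(2k+1)}\bar H_{n+k+1}(C^*_\alpha;G)\to\cdots\to\varprojlim{}^{(3)}\bar H_{n+2}(C^*_\alpha;G)\to\varprojlim{}^{(1)}\bar H_{n+1}(C^*_\alpha;G)\to\bar H_n(C^*;G)\xrightarrow{\ i_*\ }\varprojlim\bar H_n(C^*_\alpha;G)\to\varprojlim{}^{(2)}\bar H_{n+1}(C^*_\alpha;G)\to\cdots\to\varprojlim{}^{(2k)}\bar H_{n+k}(C^*_\alpha;G)\to\cdots,$$ where $i_*$ is induced by the given maps $C^*_\alpha\to C^*$. For a fixed index set, the arrows that do not involve $C^*$ are natural in the direct system, and the arrows into and out of $\bar H_n(C^*;G)$ are natural with respect to commutative squares of homomorphisms of associated direct systems and of their target complexes. -/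

import Mathlib

open CategoryTheory CategoryTheory.Limits Opposite

universe u

noncomputable section

namespace BarHomology

section Cone

variable {R : Type u} [CommRing R] {G' G'' : Type u} [AddCommGroup G'] [Module R G']
  [AddCommGroup G''] [Module R G'']

/-- The boundary `C_{n+1}(β_#) → C_n(β_#)`,
`∂(φ', φ'') = (φ' ∘ δ, β ∘ φ' - φ'' ∘ δ)`, where
`C_n(β_#) = Hom(C^n, G') ⊕ Hom(C^{n+1}, G'')`. -/
def coneD (β : G' →ₗ[R] G'') (C : CochainComplex (ModuleCat.{u} R) ℤ) (n : ℤ) :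
    ((C.X (n + 1) →ₗ[R] G') × (C.X (n + 1 + 1) →ₗ[R] G'')) →ₗ[R]
      ((C.X n →ₗ[R] G') × (C.X (n + 1) →ₗ[R] G'')) where
  toFun φ := (φ.1 ∘ₗ (C.d n (n + 1)).hom,
    β ∘ₗ φ.1 - φ.2 ∘ₗ (C.d (n + 1) (n + 1 + 1)).hom)
  map_add' φ ψ := by
    ext x
    · simp
    · simp only [Prod.fst_add, Prod.snd_add, LinearMap.sub_apply, LinearMap.comp_apply,
        LinearMap.add_apply, map_add]
      abel
  map_smul' r φ := by
    ext x
    · simp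
    · simp [smul_sub]

/-- The chain complex `C_*(β_#) = Hom(C^*, β_#)`, indexed by `ℤ`: in degree `n` it is
`Hom(C^n, G') ⊕ Hom(C^{n+1}, G'')`, and
`∂(φ', φ'') = (φ' ∘ δ, β ∘ φ' - φ'' ∘ δ)`. -/
def coneComplex (β : G' →ₗ[R] G'') (C : CochainComplex (ModuleCat.{u} R) ℤ) :
    ChainComplex (ModuleCat.{u} R) ℤ :=
  ChainComplex.of
    (fun n => ModuleCat.of R ((C.X n →ₗ[R] G') × (C.X (n + 1) →ₗ[R] G'')))
    (fun n => ModuleCat.ofHom (coneD β C n))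
    (fun n => by
      have h : ∀ (i : ℤ) (x : C.X i), (C.d (i + 1) (i + 1 + 1)).hom
          ((C.d i (i + 1)).hom x) = 0 := fun i x => by
        have := C.d_comp_d i (i + 1) (i + 1 + 1)
        exact congrArg (fun f => f.hom x) this
      ext φ x <;> simp [coneD, h])

/-- The map `C_*'(β_#) → C_*(β_#)`, `(φ', φ'') ↦ (φ' ∘ f, φ'' ∘ f)`, induced by a cochain map
`f : C^* → C'^*`. -/
def coneMap (β : G' →ₗ[R] G'') {C C' : CochainComplex (ModuleCat.{u} R) ℤ} (f : C ⟶ C') :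
    coneComplex β C' ⟶ coneComplex β C :=
  ChainComplex.ofHom
    (fun n => ModuleCat.ofHom (LinearMap.prodMap
      (LinearMap.lcomp R G' (f.f n).hom) (LinearMap.lcomp R G'' (f.f (n + 1)).hom)))
    (fun n => by
      have h : ∀ (i : ℤ) (x : C.X i), (C'.d i (i + 1)).hom ((f.f i).hom x) =
          (f.f (i + 1)).hom ((C.d i (i + 1)).hom x) := fun i x =>
        congrArg (fun f => f.hom x) (f.comm i (i + 1))
      simp only [coneComplex, ChainComplex.of_d]
      ext φ x <;> simp [coneD, h])

/-- `C^* ↦ C_*(β_#)` as a contravariant functor. -/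
def coneFunctor (β : G' →ₗ[R] G'') :
    (CochainComplex (ModuleCat.{u} R) ℤ)ᵒᵖ ⥤ ChainComplex (ModuleCat.{u} R) ℤ where
  obj C := coneComplex β C.unop
  map f := coneMap β f.unop
  map_id _ := HomologicalComplex.hom_ext _ _ fun _ => rfl
  map_comp _ _ := HomologicalComplex.hom_ext _ _ fun _ => rfl

/-- The homology `H̄_n(C^*; G) = H_n(C_*(β_#))` generated by a cochain complex, as a
contravariant functor; `β : G' → G''` is the second map of an injective resolution
`0 → G → G' → G'' → 0`. -/
def barH (β : G' →ₗ[R] G'') (n : ℤ) :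
    (CochainComplex (ModuleCat.{u} R) ℤ)ᵒᵖ ⥤ ModuleCat.{u} R :=
  coneFunctor β ⋙ HomologicalComplex.homologyFunctor _ _ n

end Cone

section Systems

variable {R : Type u} [CommRing R] {J : Type u} [Preorder J]

/-- A homomorphism `φ` from a direct system `D = {C^*_α}` of cochain complexes to a cochain
complex `C` exhibits `D` as associated with `C` if it induces isomorphisms
`colim_α H^n(C^*_α) → H^n(C)` for all `n`. -/
def IsAssociated {D : J ⥤ CochainComplex (ModuleCat.{u} R) ℤ}
    {C : CochainComplex (ModuleCat.{u} R) ℤ} (φ : D ⟶ (Functor.const J).obj C) : Prop :=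
  ∀ n : ℤ, IsIso (colimit.desc (D ⋙ HomologicalComplex.homologyFunctor _ _ n)
    ((HomologicalComplex.homologyFunctor _ _ n).mapCocone (Cocone.mk C φ)))

/-- Inverse systems of `R`-modules indexed by `J` form a Grothendieck abelian category, so that
the right derived functors of the inverse limit are defined. -/
instance : IsGrothendieckAbelian.{u} (Jᵒᵖ ⥤ ModuleCat.{u} R) where
  ab5OfSize := ⟨fun _ _ _ => inferInstance⟩

instance : (lim : (Jᵒᵖ ⥤ ModuleCat.{u} R) ⥤ ModuleCat.{u} R).Additive where
  map_add {X Y f g} := by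
    apply limit.hom_ext
    intro j
    simp [Preadditive.add_comp, Preadditive.comp_add]

variable {G' G'' : Type u} [AddCommGroup G'] [Module R G'] [AddCommGroup G''] [Module R G'']

variable (J) in
/-- A direct system `D = {C^*_α}` gives the inverse system `{H̄_n(C^*_α; G)}`,
contravariantly in `D`. -/
def barHSystem (β : G' →ₗ[R] G'') (n : ℤ) :
    (J ⥤ CochainComplex (ModuleCat.{u} R) ℤ)ᵒᵖ ⥤ (Jᵒᵖ ⥤ ModuleCat.{u} R) :=
  Functor.opHom J _ ⋙ (Functor.whiskeringRight Jᵒᵖ _ _).obj (barH β n)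

variable (J) in
/-- `D ↦ lim_α H̄_n(C^*_α; G)`. -/
def limBarH (β : G' →ₗ[R] G'') (n : ℤ) :
    (J ⥤ CochainComplex (ModuleCat.{u} R) ℤ)ᵒᵖ ⥤ ModuleCat.{u} R :=
  barHSystem J β n ⋙ lim

variable (J) in
/-- `D ↦ lim^(i)_α H̄_n(C^*_α; G)`, where `lim^(i)` is the `i`-th right derived functor of the
inverse limit functor on inverse systems of `R`-modules indexed by `J`. -/
def derivedLimBarH (β : G' →ₗ[R] G'') (i : ℕ) (n : ℤ) :
    (J ⥤ CochainComplex (ModuleCat.{u} R) ℤ)ᵒᵖ ⥤ ModuleCat.{u} R :=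
  barHSystem J β n ⋙ (lim : (Jᵒᵖ ⥤ ModuleCat.{u} R) ⥤ ModuleCat.{u} R).rightDerived i

/-- The canonical homomorphism `H̄_n(C; G) → lim_α H̄_n(C^*_α; G)` whose components are induced
by the cochain maps `φ_α : C^*_α → C`. -/
def toLimBarH (β : G' →ₗ[R] G'') (n : ℤ) {D : J ⥤ CochainComplex (ModuleCat.{u} R) ℤ}
    {C : CochainComplex (ModuleCat.{u} R) ℤ} (φ : D ⟶ (Functor.const J).obj C) :
    (barH β n).obj (op C) ⟶ (limBarH J β n).obj (op D) :=
  limit.lift ((barHSystem J β n).obj (op D))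
    ((barH β n).mapCone (Cone.mk (op C) { app := fun j => (φ.app j.unop).op
                                          naturality := fun i j f => by
                                            have := φ.naturality f.unop
                                            simp only [Functor.const_obj_obj,
                                              Functor.const_obj_map,
                                              Category.comp_id] at this
                                            simp only [Functor.const_obj_obj,
                                              Functor.const_obj_map, Category.id_comp]
                                            exact congrArg Quiver.Hom.op this.symm }))

end Systems

end BarHomology

end

/-! Derived limits over `J` are computed as `Ext^p` out of the constant inverse system `R`, which
supplies natural long exact sequences. The acyclic objects come from `ext_op_homTo_eq_zero`: over a
directed set, an inverse system `Hom(A_α, I)` with `I` injective has no higher derived limits.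

Write `C_i`, `Z_i`, `B_i`, `H_i` for chains, cycles, boundaries and homology of the cone complexes
of a direct system, viewed as inverse systems. Let `K_i` be the image of `H_i` in `Hom(Z^i, G')`,
where `Z^i` are the cocycles, `Q_i` the kernel of `H_i → K_i` and `W_i` the kernel of `Z_i → K_i`.
Both `C_i` and `W_i` are extensions of systems of the form `Hom(A, I)`, hence acyclic
(`isAcyclic_coneX`, `isAcyclic_coneW`). The acyclicity of `W_i` makes the long exact sequences break
up: - `0 → W_i → Z_i → K_i → 0` gives `lim^p Z_i ≅ lim^p K_i` for `p ≥ 1`; - `0 → Z_{j+1} → C_{j+1}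
→ B_j → 0` gives `lim^p B_j ≅ lim^{p+1} Z_{j+1}` for `p ≥ 1`; - `0 → B_j → W_j → Q_j → 0` gives
`lim^p Q_j ≅ lim^{p+1} B_j` for `p ≥ 1`; - `B_j → Z_j` factors through `W_j`, so it is zero on
`lim^p` for `p ≥ 1`.

Hence for `p ≥ 1` there are exact sequences `0 → lim^p Z_j → lim^p H_j → lim^{p+2} Z_{j+1} → 0`, and
splicing them gives the arrows to the right (`exact_rightMap_rightMap`). Likewise `0 → lim^p Q_j →
lim^p H_j → lim^p K_j → 0` with `lim^p Q_j ≅ lim^{p+2} K_{j+1}` splices to the arrows on the left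
(`exact_leftMap_leftMap`).

In the middle, `Hom` turns colimits into limits, so the cone complex of `colim D` is `lim C_*`. The
map `colim D → C` is a quasi-isomorphism and stays one after passing to cone complexes
(`exists_cone_cycle`, `exists_cone_boundary`). Thus `H̄_j(C)` is `lim Z_j` modulo the image of `lim
C_{j+1}`. The part coming from `lim B_j` is `lim^1 Z_{j+1}`, and the quotient `lim Z_j / lim B_j` is
the kernel of `lim H_j → lim^1 B_j`. Combined with `lim^1 H_{j+1} ↠ lim^1 K_{j+1} ≅ lim^1 Z_{j+1}`
and `lim^1 B_j ≅ lim^2 Z_{j+1} ↪ lim^2 H_{j+1}`, this joins the two halves. -/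

noncomputable section

set_option linter.unusedSectionVars false

namespace BarHomology

open CategoryTheory.Abelian

/-! ### Covariant long exact sequences of `Ext`, in module form -/

section ExtFunctor

universe v w

variable {R : Type u} [CommRing R] {A : Type w} [Category.{v} A] [Abelian A] [Linear R A]
  [HasExt.{u} A]

variable (R) in
/-- The functor `Ext^p(K, -)` with values in `R`-modules. -/
def extFunctor (K : A) (p : ℕ) : A ⥤ ModuleCat.{u} R where
  obj M := ModuleCat.of R (Ext K M p)
  map f := ModuleCat.ofHom (Ext.postcompOfLinear (Ext.mk₀ f) R K (add_zero p))
  map_id M := by ext x; simp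
  map_comp f g := by
    ext x
    simp only [ModuleCat.hom_ofHom, ModuleCat.hom_comp, LinearMap.comp_apply,
      LinearMap.flip_apply, Ext.bilinearCompOfLinear_apply_apply, ← Ext.mk₀_comp_mk₀]
    rw [Ext.comp_assoc_of_third_deg_zero]

/-- The connecting homomorphism `Ext^p(K, S₃) → Ext^q(K, S₁)`, `q = p + 1`, of a short exact
sequence. -/
def extδ (K : A) {S : ShortComplex A} (hS : S.ShortExact) (p q : ℕ) (h : p + 1 = q) :
    (extFunctor R K p).obj S.X₃ ⟶ (extFunctor R K q).obj S.X₁ :=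
  ModuleCat.ofHom (Ext.postcompOfLinear hS.extClass R K h)

lemma extδ_naturality (K : A) {S S' : ShortComplex A} (hS : S.ShortExact) (hS' : S'.ShortExact)
    (f : S ⟶ S') (p q : ℕ) (h : p + 1 = q) :
    (extFunctor R K p).map f.τ₃ ≫ extδ K hS' p q h =
      extδ (R := R) K hS p q h ≫ (extFunctor R K q).map f.τ₁ := by
  ext x
  change (Ext.comp x (Ext.mk₀ f.τ₃) (add_zero p)).comp hS'.extClass h =
    (Ext.comp x hS.extClass h).comp (Ext.mk₀ f.τ₁) (add_zero q)
  rw [Ext.comp_assoc x _ _ (add_zero p) (zero_add 1) (by lia),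
    ← ShortComplex.ShortExact.extClass_naturality hS hS',
    Ext.comp_assoc x _ _ h (add_zero 1) (by lia)]

lemma extFunctor_exact₂ (K : A) {S : ShortComplex A} (hS : S.ShortExact) (p : ℕ) :
    Function.Exact ((extFunctor R K p).map S.f) ((extFunctor R K p).map S.g) := by
  intro x
  refine ⟨fun hx => Ext.covariant_sequence_exact₂ K hS x hx, ?_⟩
  rintro ⟨y, rfl⟩
  rw [← ConcreteCategory.comp_apply, ← Functor.map_comp, S.zero]
  change Ext.comp y (Ext.mk₀ 0) (add_zero p) = 0
  rw [Ext.mk₀_zero]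
  exact Ext.comp_zero ..

lemma extFunctor_exact₃ (K : A) {S : ShortComplex A} (hS : S.ShortExact) (p q : ℕ)
    (h : p + 1 = q) :
    Function.Exact ((extFunctor R K p).map S.g) (extδ (R := R) K hS p q h) := by
  intro x
  refine ⟨fun hx => Ext.covariant_sequence_exact₃ K hS x h hx, ?_⟩
  rintro ⟨y, rfl⟩
  change (Ext.comp y (Ext.mk₀ S.g) (add_zero p)).comp hS.extClass h = 0
  rw [Ext.comp_assoc y _ _ (add_zero p) (zero_add 1) (by lia),
    ShortComplex.ShortExact.comp_extClass]
  exact Ext.comp_zero ..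

lemma extFunctor_exact₁ (K : A) {S : ShortComplex A} (hS : S.ShortExact) (p q : ℕ)
    (h : p + 1 = q) :
    Function.Exact (extδ (R := R) K hS p q h) ((extFunctor R K q).map S.f) := by
  intro x
  refine ⟨fun hx => Ext.covariant_sequence_exact₁ K hS x hx h, ?_⟩
  rintro ⟨y, rfl⟩
  change (Ext.comp y hS.extClass h).comp (Ext.mk₀ S.f) (add_zero q) = 0
  rw [Ext.comp_assoc y _ _ h (add_zero 1) (by lia),
    ShortComplex.ShortExact.extClass_comp]
  exact Ext.comp_zero ..

end ExtFunctor

/-! ### Elementwise cycles and homology classes -/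

section Cycles

variable {R : Type u} [CommRing R] {κ : Type*} {c : ComplexShape κ}
  (K : HomologicalComplex (ModuleCat.{u} R) c)

lemma iCycles_injective (i : κ) : Function.Injective (K.iCycles i) :=
  (ModuleCat.mono_iff_injective _).1 inferInstance

lemma homologyπ_surjective (i : κ) : Function.Surjective (K.homologyπ i) :=
  (ModuleCat.epi_iff_surjective _).1 inferInstance

lemma d_iCycles_apply (i j : κ) (z : K.cycles i) : K.d i j (K.iCycles i z) = 0 :=
  congr($(K.iCycles_d i j) z)

lemma exists_iCycles_eq (i j : κ) {x : K.X i} (hj : c.next i = j) (hx : K.d i j x = 0) :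
    ∃ z : K.cycles i, K.iCycles i z = x := by
  -- An element `x` is the map `R → K.X i` with `1 ↦ x`; lift that map to the cycles and evaluate at
  -- `1`.
  refine ⟨K.liftCycles (ModuleCat.ofHom (LinearMap.toSpanSingleton R _ x)) j hj ?_ (1 : R), ?_⟩
  · ext
    simpa using hx
  · rw [← ConcreteCategory.comp_apply, K.liftCycles_i]
    simp

lemma homologyπ_eq_zero_iff (i j : κ) (z : K.cycles j) (hi : c.prev j = i) :
    K.homologyπ j z = 0 ↔ ∃ y : K.X i, K.d i j y = K.iCycles j z := by
  have h : (ShortComplex.mk (K.toCycles i j) (K.homologyπ j) (by simp)).Exact :=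
    ShortComplex.exact_of_g_is_cokernel _ (K.homologyIsCokernel i j hi)
  rw [ShortComplex.moduleCat_exact_iff] at h
  constructor
  · intro hz
    obtain ⟨y, rfl⟩ := h z hz
    exact ⟨y, congr($(K.toCycles_i i j) y).symm⟩
  · rintro ⟨y, hy⟩
    have : z = K.toCycles i j y := iCycles_injective K j <|
      hy.symm.trans congr($(K.toCycles_i i j) y).symm
    rw [this]
    exact congr($(K.toCycles_comp_homologyπ i j) y)

end Cycles

/-! ### Limits as morphisms from the constant system, and classes in `Ext` -/

section Lim

variable {R : Type u} [CommRing R] {I : Type u} [Category.{u} I]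

variable (R I) in
/-- The constant system with value `R`. -/
abbrev constR : I ⥤ ModuleCat.{u} R := (Functor.const I).obj (ModuleCat.of R R)

/-- An element of the limit as a morphism from the constant system `R`. -/
def limHomEquiv (M : I ⥤ ModuleCat.{u} R) :
    (lim.obj M : ModuleCat.{u} R) ≃ₗ[R] (constR R I ⟶ M) where
  toFun x :=
    { app i := ModuleCat.ofHom (LinearMap.toSpanSingleton R _ (limit.π M i x))
      naturality i j f := by
        ext
        have : M.map f (limit.π M i x) = limit.π M j x := by
          rw [← ConcreteCategory.comp_apply, limit.w]
        simp [this] }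
  map_add' x y := by
    ext i
    simp
  map_smul' r x := by
    ext i
    simp
  invFun f := limit.lift M (Cone.mk _ f) (1 : R)
  left_inv x := by
    apply Concrete.limit_ext
    intro i
    rw [← ConcreteCategory.comp_apply, limit.lift_π]
    simp
  right_inv f := by
    ext i
    simp only [ModuleCat.hom_ofHom, LinearMap.toSpanSingleton_apply, one_smul]
    rw [← ConcreteCategory.comp_apply, limit.lift_π]

lemma limHomEquiv_naturality {M N : I ⥤ ModuleCat.{u} R} (f : M ⟶ N)
    (x : (lim.obj M : ModuleCat.{u} R)) :
    limHomEquiv N (lim.map f x) = limHomEquiv M x ≫ f := by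
  ext i
  simp [limHomEquiv]

variable [IsGrothendieckAbelian.{u} (I ⥤ ModuleCat.{u} R)]
  [(lim : (I ⥤ ModuleCat.{u} R) ⥤ ModuleCat.{u} R).Additive]

section

variable {M : I ⥤ ModuleCat.{u} R} (P : InjectiveResolution M) (p : ℕ)

/-- The limit of an injective resolution. -/
abbrev limResolution : CochainComplex (ModuleCat.{u} R) ℕ :=
  ((lim : (I ⥤ ModuleCat.{u} R) ⥤ ModuleCat.{u} R).mapHomologicalComplex _).obj P.cocomplex

/-- The morphism from the constant system `R` defined by a cycle in the limit of an injective
resolution. -/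
def cyclesHom : (limResolution P).cycles p →ₗ[R] (constR R I ⟶ P.cocomplex.X p) :=
  (limHomEquiv (P.cocomplex.X p)).toLinearMap ∘ₗ ((limResolution P).iCycles p).hom

lemma cyclesHom_comp_d (z : (limResolution P).cycles p) :
    cyclesHom P p z ≫ P.cocomplex.d p (p + 1) = 0 := by
  refine (limHomEquiv_naturality (P.cocomplex.d p (p + 1)) _).symm.trans ?_
  have : (lim.map (P.cocomplex.d p (p + 1))) ((limResolution P).iCycles p z) = 0 :=
    congr($((limResolution P).iCycles_d p (p + 1)) z)
  exact (congrArg _ this).trans (map_zero _)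

lemma smul_extMk {K : I ⥤ ModuleCat.{u} R} (f : K ⟶ P.cocomplex.X p)
    (hf : f ≫ P.cocomplex.d p (p + 1) = 0) (r : R) :
    P.extMk (r • f) (p + 1) rfl (by simp [hf]) = r • P.extMk f (p + 1) rfl hf := by
  -- Scaling `f` is precomposing it with `r • 𝟙`, and `extMk` is compatible with precomposition.
  have h : ∀ (g : K ⟶ P.cocomplex.X p) (hg : g ≫ P.cocomplex.d p (p + 1) = 0),
      g = (r • 𝟙 K) ≫ f → P.extMk g (p + 1) rfl hg = r • P.extMk f (p + 1) rfl hf := by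
    rintro _ hg rfl
    rw [← P.mk₀_comp_extMk f _ _ hf, Ext.mk₀_smul, Ext.smul_comp, Ext.mk₀_id_comp]
  exact h _ _ (by simp)

/-- A coboundary in degree `0` comes from degree `-1`, where the resolution vanishes. -/
lemma extMk_zero_eq_zero_iff {K : I ⥤ ModuleCat.{u} R} (f : K ⟶ P.cocomplex.X 0)
    (hf : f ≫ P.cocomplex.d 0 1 = 0) : P.extMk f 1 rfl hf = 0 ↔ f = 0 := by
  constructor
  · intro h
    rw [← P.extEquivCohomologyClass.apply_eq_iff_eq,
      P.extEquivCohomologyClass_extMk, P.extEquivCohomologyClass_zero,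
      CochainComplex.HomComplex.CohomologyClass.mk_eq_zero_iff,
      CochainComplex.HomComplex.Cocycle.fromSingleMk_mem_coboundaries_iff _ _ _ _ _ (-1)
        (by simp)] at h
    obtain ⟨g, hg⟩ := h
    have : g = 0 := (P.cochainComplex.isZero_of_isStrictlyGE 0 (-1)).eq_of_tgt _ _
    rw [this, zero_comp] at hg
    rw [← cancel_mono (P.cochainComplexXIso 0 0 rfl).inv, zero_comp]
    exact hg.symm
  · rintro rfl
    simp

/-- The extension class of a cycle in the limit of an injective resolution. -/
def cyclesToExt : (limResolution P).cycles p ⟶ (extFunctor R (constR R I) p).obj M :=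
  ModuleCat.ofHom
    { toFun z := P.extMk (cyclesHom P p z) (p + 1) rfl (cyclesHom_comp_d P p z)
      map_add' x y := by
        refine Eq.trans ?_ (P.add_extMk _ _ _ _ _ _).symm
        congr 1
        exact map_add (cyclesHom P p) x y
      map_smul' r x := by
        refine Eq.trans ?_ (smul_extMk P p _ _ r)
        congr 1
        exact map_smul (cyclesHom P p) r x }

lemma cyclesToExt_apply (z : (limResolution P).cycles p) :
    cyclesToExt P p z = P.extMk (cyclesHom P p z) (p + 1) rfl (cyclesHom_comp_d P p z) := rfl

lemma cyclesToExt_surjective : Function.Surjective (cyclesToExt P p) := by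
  intro x
  obtain ⟨f, hf, rfl⟩ := P.extMk_surjective x (p + 1) rfl
  obtain ⟨y, rfl⟩ := (limHomEquiv _).surjective f
  have hy : ((limResolution P).d p (p + 1)) y = 0 := by
    apply (limHomEquiv _).injective
    exact (limHomEquiv_naturality (P.cocomplex.d p (p + 1)) y).trans (hf.trans (map_zero _).symm)
  obtain ⟨z, hz⟩ := exists_iCycles_eq (limResolution P) p (p + 1) (by simp) hy
  refine ⟨z, ?_⟩
  rw [cyclesToExt_apply]
  congr 1
  exact congrArg (limHomEquiv (P.cocomplex.X p)) hz

/-- For `p > 0` both conditions say that the cycle comes from the preceding differential, once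
elements of the limit are read as morphisms from the constant system; for `p = 0` both say that it
is zero. -/
lemma cyclesToExt_eq_zero_iff (z : (limResolution P).cycles p) :
    cyclesToExt P p z = 0 ↔ (limResolution P).homologyπ p z = 0 := by
  cases p with
  | zero =>
    refine (extMk_zero_eq_zero_iff P (cyclesHom P 0 z) (cyclesHom_comp_d P 0 z)).trans ?_
    rw [homologyπ_eq_zero_iff _ 0 _ _ (by simp)]
    constructor
    · intro h
      refine ⟨0, ?_⟩
      rw [map_zero]
      exact ((limHomEquiv _).injective (h.trans (map_zero _).symm)).symm
    · rintro ⟨y, hy⟩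
      rw [HomologicalComplex.shape _ _ _ (by simp)] at hy
      exact (congrArg (limHomEquiv (P.cocomplex.X 0)) hy.symm).trans (map_zero _)
  | succ p =>
    refine (P.extMk_eq_zero_iff (cyclesHom P (p + 1) z) _ rfl
      (cyclesHom_comp_d P (p + 1) z) p rfl).trans ?_
    rw [homologyπ_eq_zero_iff _ p _ _ (by simp)]
    constructor
    · rintro ⟨g, hg⟩
      obtain ⟨y, rfl⟩ := (limHomEquiv _).surjective g
      refine ⟨y, (limHomEquiv _).injective ?_⟩
      exact (limHomEquiv_naturality (P.cocomplex.d p (p + 1)) y).trans hg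
    · rintro ⟨y, hy⟩
      refine ⟨limHomEquiv _ y, ?_⟩
      exact (limHomEquiv_naturality (P.cocomplex.d p (p + 1)) y).symm.trans
        (congrArg (limHomEquiv _) hy)

end

end Lim

section Desc

variable {R : Type u} [CommRing R] {A B C : ModuleCat.{u} R}

/-- Factorization of a morphism through a surjection. -/
def surjDesc (f : A ⟶ B) (hf : Function.Surjective f) (g : A ⟶ C)
    (h : ∀ a, f a = 0 → g a = 0) : B ⟶ C :=
  ModuleCat.ofHom ((LinearMap.ker f.hom).liftQ g.hom h ∘ₗ
    (f.hom.quotKerEquivOfSurjective hf).symm.toLinearMap)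

lemma surjDesc_apply (f : A ⟶ B) (hf : Function.Surjective f) (g : A ⟶ C)
    (h : ∀ a, f a = 0 → g a = 0) (a : A) : surjDesc f hf g h (f a) = g a := by
  have : (f.hom.quotKerEquivOfSurjective hf).symm (f.hom a) = Submodule.Quotient.mk a := by
    rw [LinearEquiv.symm_apply_eq]
    rfl
  change (LinearMap.ker f.hom).liftQ g.hom h ((f.hom.quotKerEquivOfSurjective hf).symm (f.hom a)) = _
  rw [this]
  rfl

lemma comp_surjDesc (f : A ⟶ B) (hf : Function.Surjective f) (g : A ⟶ C)
    (h : ∀ a, f a = 0 → g a = 0) : f ≫ surjDesc f hf g h = g := by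
  ext a
  exact surjDesc_apply f hf g h a

lemma surjDesc_bijective (f : A ⟶ B) (hf : Function.Surjective f) (g : A ⟶ C)
    (h : ∀ a, f a = 0 → g a = 0) (hg : Function.Surjective g) (h' : ∀ a, g a = 0 → f a = 0) :
    Function.Bijective (surjDesc f hf g h) := by
  constructor
  · rw [injective_iff_map_eq_zero]
    intro b hb
    obtain ⟨a, rfl⟩ := hf b
    exact h' a (by rwa [surjDesc_apply] at hb)
  · intro c
    obtain ⟨a, rfl⟩ := hg c
    exact ⟨f a, surjDesc_apply f hf g h a⟩

end Desc

/-! ### Derived limits are `Ext` groups of the constant system -/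

section RightDerived

variable {R : Type u} [CommRing R] {I : Type u} [Category.{u} I]
  [IsGrothendieckAbelian.{u} (I ⥤ ModuleCat.{u} R)]
  [(lim : (I ⥤ ModuleCat.{u} R) ⥤ ModuleCat.{u} R).Additive]

/-- The homology of the limit of an injective resolution is given by extensions of the constant
system `R`. -/
def homologyToExt {M : I ⥤ ModuleCat.{u} R} (P : InjectiveResolution M) (p : ℕ) :
    (limResolution P).homology p ⟶ (extFunctor R (constR R I) p).obj M :=
  surjDesc _ (homologyπ_surjective _ p) (cyclesToExt P p)
    (fun z hz => (cyclesToExt_eq_zero_iff P p z).2 hz)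

lemma homologyπ_homologyToExt {M : I ⥤ ModuleCat.{u} R} (P : InjectiveResolution M) (p : ℕ) :
    (limResolution P).homologyπ p ≫ homologyToExt P p = cyclesToExt P p :=
  comp_surjDesc ..

instance {M : I ⥤ ModuleCat.{u} R} (P : InjectiveResolution M) (p : ℕ) :
    IsIso (homologyToExt P p) :=
  (ConcreteCategory.isIso_iff_bijective _).2 <| surjDesc_bijective _ _ _ _
    (cyclesToExt_surjective P p) (fun z hz => (cyclesToExt_eq_zero_iff P p z).1 hz)

lemma homologyToExt_naturality {M N : I ⥤ ModuleCat.{u} R} {P : InjectiveResolution M}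
    {Q : InjectiveResolution N} {f : M ⟶ N} (φ : InjectiveResolution.Hom P Q f) (p : ℕ) :
    HomologicalComplex.homologyMap
      ((lim : (I ⥤ ModuleCat.{u} R) ⥤ _).mapHomologicalComplex _ |>.map φ.hom) p ≫
        homologyToExt Q p =
      homologyToExt P p ≫ (extFunctor R (constR R I) p).map f := by
  rw [← cancel_epi ((limResolution P).homologyπ p),
    HomologicalComplex.homologyπ_naturality_assoc, homologyπ_homologyToExt,
    reassoc_of% homologyπ_homologyToExt P p]
  ext z
  refine Eq.trans ?_ (InjectiveResolution.extMk_comp_mk₀ (cyclesHom P p z) (p + 1) rfl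
    (cyclesHom_comp_d P p z) φ).symm
  refine (cyclesToExt_apply Q p _).trans ?_
  congr 1
  refine Eq.trans ?_ (limHomEquiv_naturality (φ.hom.f p) _)
  refine congrArg (limHomEquiv (Q.cocomplex.X p)) ?_
  exact congr($(HomologicalComplex.cyclesMap_i
    ((lim : (I ⥤ ModuleCat.{u} R) ⥤ _).mapHomologicalComplex _ |>.map φ.hom) p) z)

variable (R I) in
/-- The derived functors of the limit are given by extensions of the constant system `R`. -/
def rightDerivedLimIso (p : ℕ) :
    (lim : (I ⥤ ModuleCat.{u} R) ⥤ ModuleCat.{u} R).rightDerived p ≅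
      extFunctor R (constR R I) p :=
  NatIso.ofComponents
    (fun M => (injectiveResolution M).isoRightDerivedObj lim p ≪≫
      (asIso (homologyToExt (injectiveResolution M) p) :
        (limResolution (injectiveResolution M)).homology p ≅ _)) (by
    intro M N f
    let φ : InjectiveResolution.Hom (injectiveResolution M) (injectiveResolution N) f :=
      { hom := InjectiveResolution.desc f _ _
        ι_f_zero_comp_hom_f_zero := InjectiveResolution.desc_commutes_zero f _ _ }
    have h := InjectiveResolution.isoRightDerivedObj_hom_naturality f (injectiveResolution M)
      (injectiveResolution N) φ.hom (InjectiveResolution.desc_commutes_zero f _ _) lim p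
    refine (Category.assoc _ _ _).symm.trans
      ((congrArg (fun t => t ≫ homologyToExt (injectiveResolution N) p) h).trans ?_)
    refine (Category.assoc _ _ _).trans (Eq.trans ?_ (Category.assoc _ _ _).symm)
    exact congrArg (fun t => ((injectiveResolution M).isoRightDerivedObj lim p).hom ≫ t)
      (homologyToExt_naturality φ p))

variable (R I) in
/-- The limit functor is given by morphisms from the constant system `R`. -/
def limIso : (lim : (I ⥤ ModuleCat.{u} R) ⥤ ModuleCat.{u} R) ≅ extFunctor R (constR R I) 0 :=
  NatIso.ofComponents
    (fun M => ((limHomEquiv M).trans (Ext.linearEquiv₀ (R := R)).symm).toModuleIso)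
    (by
      intro M N f
      ext x
      change Ext.mk₀ (limHomEquiv N (lim.map f x)) =
        (Ext.mk₀ (limHomEquiv M x)).comp (Ext.mk₀ f) (add_zero 0)
      rw [limHomEquiv_naturality, Ext.mk₀_comp_mk₀])

end RightDerived

/-! ### Dimension shifting along an injective middle term -/

section DimensionShift

variable {A : Type*} [Category A] [Abelian A] [HasExt.{u} A] {K : A} {S : ShortComplex A}

/-- A class in `Ext^1(K, X₁)` dies in the injective `X₂`, so it is the connecting image of a
morphism `K ⟶ X₃`; if that morphism lifts to `X₂`, its connecting image is zero. -/
lemma ext_one_eq_zero_of_lift (hS : S.ShortExact) (_ : Injective S.X₂)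
    (h : ∀ f : K ⟶ S.X₃, ∃ g, g ≫ S.g = f) (x : Ext K S.X₁ 1) : x = 0 := by
  obtain ⟨y, rfl⟩ := Ext.covariant_sequence_exact₁ _ hS x (Ext.eq_zero_of_injective _) (zero_add 1)
  obtain ⟨f, rfl⟩ := Ext.mk₀_bijective _ _ |>.2 y
  obtain ⟨g, rfl⟩ := h f
  rw [← Ext.mk₀_comp_mk₀, Ext.comp_assoc _ _ _ (add_zero 0) (zero_add 1) (by lia),
    hS.comp_extClass, Ext.comp_zero]

lemma ext_succ_eq_zero_of_ext_eq_zero (hS : S.ShortExact) (_ : Injective S.X₂) {p : ℕ}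
    (h : ∀ x : Ext K S.X₃ p, x = 0) (x : Ext K S.X₁ (p + 1)) : x = 0 := by
  obtain ⟨y, rfl⟩ := Ext.covariant_sequence_exact₁ _ hS x (Ext.eq_zero_of_injective _) rfl
  rw [h y, Ext.zero_comp]

end DimensionShift

/-! ### The contravariant functor `Hom(-, I)` into an injective module -/

section Injective

variable {R : Type u} [CommRing R] {I : Type u} [AddCommGroup I] [Module R I]

/-- A linear map to an injective module factors through a linear map with a smaller kernel. -/
lemma exists_comp_eq_of_ker_le [Module.Injective R I] {A B : Type u} [AddCommGroup A] [Module R A]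
    [AddCommGroup B] [Module R B] (g : A →ₗ[R] B) (h : A →ₗ[R] I)
    (hgh : ∀ a, g a = 0 → h a = 0) : ∃ h' : B →ₗ[R] I, ∀ a, h' (g a) = h a := by
  -- `A / ker g` embeds in `B`, and `h` descends to it; injectivity of `I` then extends the
  -- descended map to all of `B`.
  have hinj : Function.Injective ((LinearMap.ker g).liftQ g le_rfl) := by
    rw [← LinearMap.ker_eq_bot]
    exact Submodule.ker_liftQ_eq_bot _ _ _ le_rfl
  obtain ⟨h', hh'⟩ := Module.Injective.out _ hinj ((LinearMap.ker g).liftQ h hgh)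
  exact ⟨h', fun a => hh' (Submodule.Quotient.mk a)⟩

variable (R I) in
/-- The contravariant functor `Hom(-, I)`. -/
def homTo : (ModuleCat.{u} R)ᵒᵖ ⥤ ModuleCat.{u} R where
  obj A := ModuleCat.of R (A.unop →ₗ[R] I)
  map f := ModuleCat.ofHom (LinearMap.lcomp R I f.unop.hom)

lemma homTo_congr {A : (ModuleCat.{u} R)ᵒᵖ} {φ ψ : (homTo R I).obj A} (h : φ = ψ) (a : A.unop) :
    (show A.unop →ₗ[R] I from φ) a = (show A.unop →ₗ[R] I from ψ) a := by rw [h]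

variable {J : Type u} [Category.{u} J]

/-- The transpose of a morphism to `Hom(A, I)`. -/
def homToFlip {A : J ⥤ ModuleCat.{u} R} {B : Jᵒᵖ ⥤ ModuleCat.{u} R}
    (g : B ⟶ A.op ⋙ homTo R I) : A ⟶ B.rightOp ⋙ homTo R I where
  app j := ModuleCat.ofHom (LinearMap.flip (M := B.obj (op j)) (g.app (op j)).hom)
  naturality i j f := by
    ext a
    refine LinearMap.ext fun b => ?_
    exact (homTo_congr (ConcreteCategory.congr_hom (g.naturality f.op) b) a).symm

/-- The inverse of `homToFlip`. -/
def homToUnflip {A : J ⥤ ModuleCat.{u} R} {B : Jᵒᵖ ⥤ ModuleCat.{u} R}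
    (g : A ⟶ B.rightOp ⋙ homTo R I) : B ⟶ A.op ⋙ homTo R I where
  app j := ModuleCat.ofHom (LinearMap.flip (M := A.obj j.unop) (g.app j.unop).hom)
  naturality i j f := by
    ext b
    refine LinearMap.ext fun a => ?_
    exact (homTo_congr (ConcreteCategory.congr_hom (g.naturality f.unop) a) b).symm

instance homTo_epi [Module.Injective R I] {A B : (ModuleCat.{u} R)ᵒᵖ} (f : A ⟶ B)
    [Mono f.unop] : Epi ((homTo R I).map f) := by
  rw [ModuleCat.epi_iff_surjective]
  intro (φ : B.unop →ₗ[R] I)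
  obtain ⟨ψ, hψ⟩ := exists_comp_eq_of_ker_le f.unop.hom φ (fun a ha => by
    have := (ModuleCat.mono_iff_injective f.unop).1 inferInstance
    exact (congrArg φ.toFun (this (ha.trans (map_zero f.unop.hom).symm))).trans (map_zero φ))
  exact ⟨ψ, LinearMap.ext hψ⟩

/-- Transposing turns the problem of extending `X ⟶ Hom(P, I)` along `X ⟶ Y` into that of lifting `P
⟶ Hom(X, I)` along `Hom(Y, I) ⟶ Hom(X, I)`. The latter is epi because `I` is injective, so
projectivity of `P` solves it. -/
instance injective_op_homTo [Module.Injective R I] (P : J ⥤ ModuleCat.{u} R) [Projective P] :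
    Injective (P.op ⋙ homTo R I) where
  factors {X Y} g f _ := by
    let f' : Y.rightOp ⋙ homTo R I ⟶ X.rightOp ⋙ homTo R I :=
      { app j := (homTo R I).map (f.app (op j)).op
        naturality i j k := by
          dsimp
          rw [← Functor.map_comp, ← Functor.map_comp, ← op_comp, ← op_comp]
          congr 2
          exact (f.naturality k.op).symm }
    have : ∀ j, Epi (f'.app j) := fun j => by
      have : Mono (f.app (op j)).op.unop := inferInstanceAs (Mono (f.app (op j)))
      exact homTo_epi (I := I) (f.app (op j)).op
    have : Epi f' := NatTrans.epi_of_epi_app _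
    refine ⟨homToUnflip (Projective.factorThru (homToFlip g) f'), ?_⟩
    ext j x
    refine LinearMap.ext fun a => ?_
    exact homTo_congr (ConcreteCategory.congr_hom (congr_app
      (Projective.factorThru_comp (homToFlip g) f') j.unop) a) x

/-- `Hom(-, I)` applied to a short complex of direct systems. -/
def homToShortComplex (I : Type u) [AddCommGroup I] [Module R I]
    (S : ShortComplex (J ⥤ ModuleCat.{u} R)) : ShortComplex (Jᵒᵖ ⥤ ModuleCat.{u} R) where
  X₁ := S.X₃.op ⋙ homTo R I
  X₂ := S.X₂.op ⋙ homTo R I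
  X₃ := S.X₁.op ⋙ homTo R I
  f := Functor.whiskerRight (NatTrans.op S.g) _
  g := Functor.whiskerRight (NatTrans.op S.f) _
  zero := by
    ext j φ
    refine LinearMap.ext fun a => ?_
    have : S.g.app j.unop (S.f.app j.unop a) = 0 :=
      congr($(congr_app S.zero j.unop) a)
    exact (congrArg (show S.X₃.obj j.unop →ₗ[R] I from φ) this).trans (map_zero _)

end Injective

/-! ### Short exactness of functors, checked pointwise -/

section Pointwise

variable {R : Type u} [CommRing R] {𝒞 : Type*} [Category 𝒞]

/-- Short exactness of a short complex of module-valued functors is checked on elements. -/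
lemma shortExact_of_pointwise (S : ShortComplex (𝒞 ⥤ ModuleCat.{u} R))
    (hf : ∀ c, Function.Injective (S.f.app c)) (hg : ∀ c, Function.Surjective (S.g.app c))
    (h : ∀ c (x : S.X₂.obj c), S.g.app c x = 0 → ∃ y, S.f.app c y = x) : S.ShortExact := by
  have : Mono S.f := by
    have : ∀ c, Mono (S.f.app c) := fun c => (ModuleCat.mono_iff_injective _).2 (hf c)
    exact NatTrans.mono_of_mono_app _
  have : Epi S.g := by
    have : ∀ c, Epi (S.g.app c) := fun c => (ModuleCat.epi_iff_surjective _).2 (hg c)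
    exact NatTrans.epi_of_epi_app _
  refine ⟨?_⟩
  rw [ShortComplex.exact_iff_isZero_homology]
  refine Functor.isZero _ fun c => ?_
  refine IsZero.of_iso ?_ (S.mapHomologyIso ((evaluation 𝒞 (ModuleCat.{u} R)).obj c)).symm
  rw [← ShortComplex.exact_iff_isZero_homology, ShortComplex.moduleCat_exact_iff]
  exact h c

end Pointwise

section Evaluation

variable {R : Type u} [CommRing R] {𝒞 : Type*} [Category 𝒞]
  {S : ShortComplex (𝒞 ⥤ ModuleCat.{u} R)}

lemma shortExact_app (hS : S.ShortExact) (c : 𝒞) :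
    (S.map ((evaluation 𝒞 (ModuleCat.{u} R)).obj c)).ShortExact :=
  hS.map_of_exact _

lemma shortExact_app_injective (hS : S.ShortExact) (c : 𝒞) : Function.Injective (S.f.app c) :=
  (shortExact_app hS c).moduleCat_injective_f

lemma shortExact_app_surjective (hS : S.ShortExact) (c : 𝒞) : Function.Surjective (S.g.app c) :=
  (shortExact_app hS c).moduleCat_surjective_g

lemma shortExact_app_exact (hS : S.ShortExact) (c : 𝒞) (x : S.X₂.obj c)
    (hx : S.g.app c x = 0) : ∃ y, S.f.app c y = x :=
  (ShortComplex.moduleCat_exact_iff _).1 (shortExact_app hS c).exact x hx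

end Evaluation

/-! ### Acyclicity of `Hom(A, I)` over a directed set -/

section Acyclic

variable {R : Type u} [CommRing R] {I : Type u} [AddCommGroup I] [Module R I]

lemma homToShortComplex_shortExact {J : Type u} [Category.{u} J] [Module.Injective R I]
    {S : ShortComplex (J ⥤ ModuleCat.{u} R)} (hS : S.ShortExact) :
    (homToShortComplex I S).ShortExact := by
  refine shortExact_of_pointwise _ (fun c φ ψ h => ?_) (fun c => ?_) (fun c φ h => ?_)
  · refine LinearMap.ext fun a => ?_
    obtain ⟨b, rfl⟩ := shortExact_app_surjective hS c.unop a
    exact homTo_congr h b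
  · have : Mono (S.f.app c.unop).op.unop :=
      (ModuleCat.mono_iff_injective _).2 (shortExact_app_injective hS c.unop)
    have h := homTo_epi (I := I) (S.f.app c.unop).op
    exact (ModuleCat.epi_iff_surjective _).1 h
  · obtain ⟨ψ, hψ⟩ := exists_comp_eq_of_ker_le (S.g.app c.unop).hom
      (show S.X₂.obj c.unop →ₗ[R] I from φ) (fun a ha => by
        obtain ⟨b, rfl⟩ := shortExact_app_exact hS c.unop a ha
        exact homTo_congr h b)
    exact ⟨ψ, LinearMap.ext hψ⟩

/-- The left adjoint of evaluation at `j` preserves projectives. Applied to a projective cover of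
each `A_j` and summed over `j`, it gives a projective mapping onto `A`: at `j`, the summand of index
`j` already surjects, since its composite with the adjunction unit is the chosen epimorphism onto
`A_j`. -/
instance enoughProjectives_functor {J : Type u} [Category.{u} J] :
    EnoughProjectives (J ⥤ ModuleCat.{u} R) where
  presentation A := by
    let F (j : J) : J ⥤ ModuleCat.{u} R :=
      (evaluationLeftAdjoint (ModuleCat.{u} R) j).obj (Projective.over (A.obj j))
    have (j : J) : Projective (F j) :=
      (evaluationAdjunctionRight (ModuleCat.{u} R) j).map_projective _ inferInstance
    let t (j : J) : F j ⟶ A :=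
      ((evaluationAdjunctionRight (ModuleCat.{u} R) j).homEquiv _ _).symm
        (Projective.π (A.obj j))
    have ht (j : J) : Epi ((Sigma.desc t).app j) := by
      have h := ((evaluationAdjunctionRight (ModuleCat.{u} R) j).homEquiv _ _).apply_symm_apply
        (Projective.π (A.obj j))
      rw [Adjunction.homEquiv_unit] at h
      have h' : (Sigma.ι F j ≫ Sigma.desc t).app j = (t j).app j := by simp
      rw [NatTrans.comp_app] at h'
      have : Epi ((t j).app j) := by
        refine @epi_of_epi _ _ _ _ _ ((evaluationAdjunctionRight _ j).unit.app _) _ ?_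
        erw [h]
        infer_instance
      rw [← h'] at this
      exact epi_of_epi ((Sigma.ι F j).app j) _
    have : Epi (Sigma.desc t) := NatTrans.epi_of_epi_app _
    exact ⟨{ p := ∐ F, f := Sigma.desc t }⟩

variable {J : Type u} [Preorder J] [IsDirectedOrder J] [Nonempty J]

/-- The constant functor is right adjoint to `colim`, which preserves monomorphisms because `J` is
directed. This is where directedness enters the acyclicity argument. -/
lemma injective_const [Module.Injective R I] :
    Injective ((Functor.const J).obj (ModuleCat.of R I)) := by
  have : Injective (ModuleCat.of R I) :=
    (Module.injective_iff_injective_object R I).1 inferInstance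
  have : (colim : (J ⥤ ModuleCat.{u} R) ⥤ _).PreservesMonomorphisms := inferInstance
  exact Injective.injective_of_adjoint (colimConstAdj (J := J) (C := ModuleCat.{u} R)) _

/-- A morphism from the constant system `R` to `Hom(A, I)` is the same as a morphism from `A` to the
constant system `I`, which is injective. -/
lemma exists_extension_homTo [Module.Injective R I] {A B : J ⥤ ModuleCat.{u} R} (i : A ⟶ B)
    [Mono i] (f : constR R Jᵒᵖ ⟶ A.op ⋙ homTo R I) :
    ∃ g : constR R Jᵒᵖ ⟶ B.op ⋙ homTo R I,
      g ≫ Functor.whiskerRight (NatTrans.op i) (homTo R I) = f := by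
  let f' : A ⟶ (Functor.const J).obj (ModuleCat.of R I) :=
    { app j := ModuleCat.ofHom (show A.obj j →ₗ[R] I from f.app (op j) (1 : R))
      naturality j k h := by
        ext a
        exact homTo_congr (ConcreteCategory.congr_hom (f.naturality h.op) (1 : R)) a |>.symm }
  have := injective_const (R := R) (I := I) (J := J)
  let g' := Injective.factorThru f' i
  refine ⟨{
    app j := ModuleCat.ofHom (LinearMap.toSpanSingleton R (B.obj j.unop →ₗ[R] I)
      (g'.app j.unop).hom)
    naturality j k h := by
      ext
      refine LinearMap.ext fun a => ?_
      have := ConcreteCategory.congr_hom (g'.naturality h.unop) a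
      change (1 : R) • g'.app _ a = (1 : R) • g'.app _ (B.map h.unop a)
      congr 1
      exact this.symm }, ?_⟩
  ext j
  refine LinearMap.ext fun a => ?_
  refine (one_smul R _).trans ?_
  exact ConcreteCategory.congr_hom (congr_app (Injective.comp_factorThru f' i) j.unop) a

/-- The inverse system `Hom(A, I)` is acyclic for the inverse limit over a directed set. -/
lemma ext_op_homTo_eq_zero [Module.Injective R I] (A : J ⥤ ModuleCat.{u} R) (p : ℕ)
    (x : Ext (constR R Jᵒᵖ) (A.op ⋙ homTo R I) (p + 1)) : x = 0 := by
  have hS (A : J ⥤ ModuleCat.{u} R) : (ShortComplex.mk (kernel.ι (Projective.π A))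
      (Projective.π A) (by simp)).ShortExact :=
    { exact := ShortComplex.exact_of_f_is_kernel _ (kernelIsKernel _) }
  -- Present `A` as a quotient of a projective `P` with kernel `N`. Then `0 → Hom(A, I) → Hom(P, I)
  -- → Hom(N, I) → 0` has injective middle term, so the vanishing for `A` in degree `p + 2` follows
  -- from that for `N` in degree `p + 1`; hence the generalization over `A`.
  induction p generalizing A with
  | zero =>
    exact ext_one_eq_zero_of_lift (homToShortComplex_shortExact (I := I) (hS A))
      (injective_op_homTo (Projective.over A))
      (fun f => exists_extension_homTo (kernel.ι (Projective.π A)) f) x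
  | succ p ih =>
    exact ext_succ_eq_zero_of_ext_eq_zero (homToShortComplex_shortExact (I := I) (hS A))
      (injective_op_homTo (Projective.over A)) (ih (kernel (Projective.π A))) x

end Acyclic

/-! ### Derived limits of `E(D)`, as functors of `E` and of `D` -/

section ExtSystem

variable {R : Type u} [CommRing R] {𝒞 : Type*} [Category 𝒞] (J : Type u) [Preorder J]

/-- The inverse system obtained by applying a contravariant functor `E` to a direct system,
contravariantly in the direct system. -/
def inverseSystem (E : 𝒞ᵒᵖ ⥤ ModuleCat.{u} R) : (J ⥤ 𝒞)ᵒᵖ ⥤ (Jᵒᵖ ⥤ ModuleCat.{u} R) :=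
  Functor.opHom J 𝒞 ⋙ (Functor.whiskeringRight Jᵒᵖ _ _).obj E

/-- `D ↦ Ext^p(R, E(D))`, i.e. the `p`-th derived limit of the inverse system `E(D)`. -/
def extSystem (E : 𝒞ᵒᵖ ⥤ ModuleCat.{u} R) (p : ℕ) : (J ⥤ 𝒞)ᵒᵖ ⥤ ModuleCat.{u} R :=
  inverseSystem J E ⋙ extFunctor R (constR R Jᵒᵖ) p

/-- The functoriality of `extSystem` in the coefficient functor. -/
def extSystemMap {E E' : 𝒞ᵒᵖ ⥤ ModuleCat.{u} R} (η : E ⟶ E') (p : ℕ) :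
    extSystem J E p ⟶ extSystem J E' p :=
  Functor.whiskerRight (Functor.whiskerLeft _ ((Functor.whiskeringRight Jᵒᵖ _ _).map η)) _

lemma extSystemMap_comp {E E' E'' : 𝒞ᵒᵖ ⥤ ModuleCat.{u} R} (η : E ⟶ E') (η' : E' ⟶ E'')
    (p : ℕ) : extSystemMap J (η ≫ η') p = extSystemMap J η p ≫ extSystemMap J η' p := by
  ext D : 2
  exact (extFunctor R (constR R Jᵒᵖ) p).map_comp
    (((Functor.whiskeringRight Jᵒᵖ 𝒞ᵒᵖ _).map η).app ((Functor.opHom J 𝒞).obj D))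
    (((Functor.whiskeringRight Jᵒᵖ 𝒞ᵒᵖ _).map η').app ((Functor.opHom J 𝒞).obj D))

variable {J}

/-- The short complex of inverse systems defined by a direct system and a short complex of
functors. -/
def inverseSystemShortComplex (S : ShortComplex (𝒞ᵒᵖ ⥤ ModuleCat.{u} R)) (D : (J ⥤ 𝒞)ᵒᵖ) :
    ShortComplex (Jᵒᵖ ⥤ ModuleCat.{u} R) where
  X₁ := (inverseSystem J S.X₁).obj D
  X₂ := (inverseSystem J S.X₂).obj D
  X₃ := (inverseSystem J S.X₃).obj D
  f := ((Functor.whiskeringRight Jᵒᵖ _ _).map S.f).app _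
  g := ((Functor.whiskeringRight Jᵒᵖ _ _).map S.g).app _
  zero := by
    ext j : 2
    exact congr_app S.zero (op (D.unop.obj j.unop))

/-- The functoriality of `inverseSystemShortComplex` in the direct system. -/
def inverseSystemShortComplexMap (S : ShortComplex (𝒞ᵒᵖ ⥤ ModuleCat.{u} R)) {D D' : (J ⥤ 𝒞)ᵒᵖ}
    (f : D ⟶ D') : inverseSystemShortComplex S D ⟶ inverseSystemShortComplex S D' where
  τ₁ := (inverseSystem J S.X₁).map f
  τ₂ := (inverseSystem J S.X₂).map f
  τ₃ := (inverseSystem J S.X₃).map f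
  comm₁₂ := by
    ext j : 2
    exact S.f.naturality (f.unop.app j.unop).op
  comm₂₃ := by
    ext j : 2
    exact S.g.naturality (f.unop.app j.unop).op

lemma shortExact_inverseSystem {S : ShortComplex (𝒞ᵒᵖ ⥤ ModuleCat.{u} R)} (hS : S.ShortExact)
    (D : (J ⥤ 𝒞)ᵒᵖ) : (inverseSystemShortComplex S D).ShortExact :=
  shortExact_of_pointwise _ (fun j => shortExact_app_injective hS (op (D.unop.obj j.unop)))
    (fun j => shortExact_app_surjective hS (op (D.unop.obj j.unop)))
    (fun j => shortExact_app_exact hS (op (D.unop.obj j.unop)))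

/-- The connecting homomorphisms of `extSystem` on a single direct system. -/
def extSystemδApp {S : ShortComplex (𝒞ᵒᵖ ⥤ ModuleCat.{u} R)} (hS : S.ShortExact) (p q : ℕ)
    (h : p + 1 = q) (D : (J ⥤ 𝒞)ᵒᵖ) : (extSystem J S.X₃ p).obj D ⟶ (extSystem J S.X₁ q).obj D :=
  extδ (R := R) (constR R Jᵒᵖ) (shortExact_inverseSystem hS D) p q h

lemma extSystemδApp_naturality {S : ShortComplex (𝒞ᵒᵖ ⥤ ModuleCat.{u} R)} (hS : S.ShortExact)
    (p q : ℕ) (h : p + 1 = q) {D D' : (J ⥤ 𝒞)ᵒᵖ} (f : D ⟶ D') :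
    (extSystem J S.X₃ p).map f ≫ extSystemδApp hS p q h D' =
      extSystemδApp hS p q h D ≫ (extSystem J S.X₁ q).map f := by
  have := extδ_naturality (R := R) (constR R Jᵒᵖ) (shortExact_inverseSystem hS D)
    (shortExact_inverseSystem hS D') (inverseSystemShortComplexMap S f) p q h
  unfold extSystemδApp
  exact this

variable (J) in
/-- The connecting homomorphisms of `extSystem`. -/
def extSystemδ {S : ShortComplex (𝒞ᵒᵖ ⥤ ModuleCat.{u} R)} (hS : S.ShortExact) (p q : ℕ)
    (h : p + 1 = q) : extSystem J S.X₃ p ⟶ extSystem J S.X₁ q where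
  app D := extSystemδApp hS p q h D
  naturality _ _ f := extSystemδApp_naturality hS p q h f

section

variable {S : ShortComplex (𝒞ᵒᵖ ⥤ ModuleCat.{u} R)} (hS : S.ShortExact) (D : (J ⥤ 𝒞)ᵒᵖ)
include hS

lemma extSystem_exact₂ (p : ℕ) :
    Function.Exact ((extSystemMap J S.f p).app D) ((extSystemMap J S.g p).app D) :=
  extFunctor_exact₂ (constR R Jᵒᵖ) (shortExact_inverseSystem hS D) p

lemma extSystem_exact₃ (p q : ℕ) (h : p + 1 = q) :
    Function.Exact ((extSystemMap J S.g p).app D) ((extSystemδ J hS p q h).app D) :=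
  extFunctor_exact₃ (constR R Jᵒᵖ) (shortExact_inverseSystem hS D) p q h

lemma extSystem_exact₁ (p q : ℕ) (h : p + 1 = q) :
    Function.Exact ((extSystemδ J hS p q h).app D) ((extSystemMap J S.f q).app D) :=
  extFunctor_exact₁ (constR R Jᵒᵖ) (shortExact_inverseSystem hS D) p q h

end

variable (J) in
/-- A functor is acyclic if it turns direct systems into acyclic inverse systems. -/
def IsAcyclic (E : 𝒞ᵒᵖ ⥤ ModuleCat.{u} R) : Prop :=
  ∀ (D : (J ⥤ 𝒞)ᵒᵖ) (p : ℕ), Subsingleton ((extSystem J E (p + 1)).obj D)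

lemma IsAcyclic.eq_zero {E : 𝒞ᵒᵖ ⥤ ModuleCat.{u} R} (hE : IsAcyclic J E) {D : (J ⥤ 𝒞)ᵒᵖ} {p : ℕ}
    (hp : 1 ≤ p) (x : (extSystem J E p).obj D) : x = 0 := by
  obtain ⟨p, rfl⟩ := Nat.exists_eq_add_of_le' hp
  have := hE D p
  exact Subsingleton.elim _ _

lemma isAcyclic_of_shortExact {S : ShortComplex (𝒞ᵒᵖ ⥤ ModuleCat.{u} R)} (hS : S.ShortExact)
    (h₁ : IsAcyclic J S.X₁) (h₃ : IsAcyclic J S.X₃) : IsAcyclic J S.X₂ := by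
  intro D p
  refine subsingleton_of_forall_eq 0 fun x => ?_
  obtain ⟨y, rfl⟩ := (extSystem_exact₂ hS D (p + 1) x).1 (h₃.eq_zero (by lia) _)
  rw [h₁.eq_zero (by lia) y, map_zero]

lemma isAcyclic_homTo [IsDirectedOrder J] [Nonempty J] {I : Type u} [AddCommGroup I] [Module R I]
    [Module.Injective R I] (F : 𝒞 ⥤ ModuleCat.{u} R) : IsAcyclic J (F.op ⋙ homTo R I) :=
  fun D p => subsingleton_of_forall_eq 0
    (fun x => ext_op_homTo_eq_zero (I := I) (D.unop ⋙ F) p x)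

section

variable {S : ShortComplex (𝒞ᵒᵖ ⥤ ModuleCat.{u} R)} (hS : S.ShortExact) (D : (J ⥤ 𝒞)ᵒᵖ)
include hS

lemma extSystemδ_surjective (h₂ : IsAcyclic J S.X₂) (p q : ℕ) (h : p + 1 = q) :
    Function.Surjective ((extSystemδ J hS p q h).app D) := fun x =>
  (extSystem_exact₁ hS D p q h x).1 (h₂.eq_zero (by lia) _)

lemma extSystemδ_bijective (h₂ : IsAcyclic J S.X₂) (p q : ℕ) (h : p + 1 = q) (hp : 1 ≤ p) :
    Function.Bijective ((extSystemδ J hS p q h).app D) := by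
  refine ⟨?_, extSystemδ_surjective hS D h₂ p q h⟩
  rw [injective_iff_map_eq_zero]
  intro x hx
  obtain ⟨y, rfl⟩ := (extSystem_exact₃ hS D p q h x).1 hx
  rw [h₂.eq_zero hp y, map_zero]

lemma extSystemMap_g_injective (h₁ : IsAcyclic J S.X₁) (p : ℕ) (hp : 1 ≤ p) :
    Function.Injective ((extSystemMap J S.g p).app D) := by
  rw [injective_iff_map_eq_zero]
  intro x hx
  obtain ⟨y, rfl⟩ := (extSystem_exact₂ hS D p x).1 hx
  rw [h₁.eq_zero hp y, map_zero]

lemma extSystemMap_g_surjective (h₁ : IsAcyclic J S.X₁) (p : ℕ) :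
    Function.Surjective ((extSystemMap J S.g p).app D) := fun x =>
  (extSystem_exact₃ hS D p (p + 1) rfl x).1 (h₁.eq_zero (by lia) _)

end

end ExtSystem

/-! ### Short exact sequences attached to composable maps `E → H → V` -/

section KernelsAndRanges

variable {R : Type u} [CommRing R] {𝒞 : Type*} [Category 𝒞] {E F H V : 𝒞 ⥤ ModuleCat.{u} R}

lemma natTrans_naturality_apply (η : E ⟶ F) {c d : 𝒞} (f : c ⟶ d) (x : E.obj c) :
    η.app d (E.map f x) = F.map f (η.app c x) :=
  ConcreteCategory.congr_hom (η.naturality f) x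

/-- The pointwise kernel of a morphism of module-valued functors. -/
def kerFunctor (η : E ⟶ F) : 𝒞 ⥤ ModuleCat.{u} R where
  obj c := ModuleCat.of R (LinearMap.ker (η.app c).hom)
  map {c d} f := ModuleCat.ofHom ((E.map f).hom.restrict fun x (hx : η.app c x = 0) =>
    show η.app d (E.map f x) = 0 by rw [natTrans_naturality_apply, hx, map_zero])
  map_id c := by ext x; exact ConcreteCategory.congr_hom (E.map_id c) x.1
  map_comp f g := by ext x; exact ConcreteCategory.congr_hom (E.map_comp f g) x.1

/-- The inclusion of the pointwise kernel. -/
def kerFunctorι (η : E ⟶ F) : kerFunctor η ⟶ E where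
  app c := ModuleCat.ofHom (Submodule.subtype _)

/-- The pointwise range of a morphism of module-valued functors. -/
def rangeFunctor (η : E ⟶ F) : 𝒞 ⥤ ModuleCat.{u} R where
  obj c := ModuleCat.of R (LinearMap.range (η.app c).hom)
  map {c d} f := ModuleCat.ofHom ((F.map f).hom.restrict (by
    rintro _ ⟨x, rfl⟩
    exact ⟨E.map f x, natTrans_naturality_apply η f x⟩))
  map_id c := by ext x; exact ConcreteCategory.congr_hom (F.map_id c) x.1
  map_comp f g := by ext x; exact ConcreteCategory.congr_hom (F.map_comp f g) x.1

/-- The projection to the pointwise range. -/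
def toRangeFunctor (η : E ⟶ F) : E ⟶ rangeFunctor η where
  app c := ModuleCat.ofHom (η.app c).hom.rangeRestrict
  naturality c d f := by
    ext x
    exact Subtype.ext (natTrans_naturality_apply η f x)

lemma toRangeFunctor_surjective (η : E ⟶ F) (c : 𝒞) :
    Function.Surjective ((toRangeFunctor η).app c) :=
  LinearMap.surjective_rangeRestrict _

lemma toRangeFunctor_eq_zero_iff (η : E ⟶ F) {c : 𝒞} (x : E.obj c) :
    (toRangeFunctor η).app c x = 0 ↔ η.app c x = 0 :=
  ⟨fun h => congrArg Subtype.val h, fun h => Subtype.ext h⟩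

/-- The morphism induced on kernels. -/
def kerFunctorMap (η : E ⟶ F) (θ : H ⟶ V) (a : E ⟶ H) (b : F ⟶ V) (h : a ≫ θ = η ≫ b) :
    kerFunctor η ⟶ kerFunctor θ where
  app c := ModuleCat.ofHom ((a.app c).hom.restrict fun x (hx : η.app c x = 0) =>
    show θ.app c (a.app c x) = 0 from
      (ConcreteCategory.congr_hom (congr_app h c) x).trans
        ((congrArg (b.app c) hx).trans (map_zero _)))
  naturality c d f := by
    ext x
    exact Subtype.ext (natTrans_naturality_apply a f x.1)

variable (π : E ⟶ H) (w : H ⟶ V)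

/-- `0 → ker π → E → H → 0` for a surjection `π`. -/
def kerShortComplex : ShortComplex (𝒞 ⥤ ModuleCat.{u} R) where
  X₁ := kerFunctor π
  X₂ := E
  X₃ := H
  f := kerFunctorι π
  g := π
  zero := by ext c x; exact x.2

/-- `0 → ker w → H → im w → 0`. -/
def kerRangeShortComplex : ShortComplex (𝒞 ⥤ ModuleCat.{u} R) where
  X₁ := kerFunctor w
  X₂ := H
  X₃ := rangeFunctor w
  f := kerFunctorι w
  g := toRangeFunctor w
  zero := by ext c x; exact (toRangeFunctor_eq_zero_iff w _).2 x.2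

/-- `0 → ker (π ≫ w) → E → im w → 0` for a surjection `π`. -/
def kerCompRangeShortComplex : ShortComplex (𝒞 ⥤ ModuleCat.{u} R) where
  X₁ := kerFunctor (π ≫ w)
  X₂ := E
  X₃ := rangeFunctor w
  f := kerFunctorι (π ≫ w)
  g := π ≫ toRangeFunctor w
  zero := by ext c x; exact (toRangeFunctor_eq_zero_iff w _).2 x.2

/-- `0 → ker π → ker (π ≫ w) → ker w → 0` for a surjection `π`. -/
def kerKerShortComplex : ShortComplex (𝒞 ⥤ ModuleCat.{u} R) where
  X₁ := kerFunctor π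
  X₂ := kerFunctor (π ≫ w)
  X₃ := kerFunctor w
  f := kerFunctorMap π (π ≫ w) (𝟙 E) w (Category.id_comp _)
  g := kerFunctorMap (π ≫ w) w π (𝟙 V) (Category.comp_id _).symm
  zero := by ext c x; exact Subtype.ext x.2

lemma kerRangeShortComplex_shortExact : (kerRangeShortComplex w).ShortExact :=
  shortExact_of_pointwise _ (fun _ => Subtype.val_injective) (toRangeFunctor_surjective w)
    (fun _ x hx => ⟨⟨x, (toRangeFunctor_eq_zero_iff w x).1 hx⟩, rfl⟩)

variable {π} (hπ : ∀ c, Function.Surjective (π.app c))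
include hπ

lemma kerShortComplex_shortExact : (kerShortComplex π).ShortExact :=
  shortExact_of_pointwise _ (fun _ => Subtype.val_injective) hπ (fun _ x hx => ⟨⟨x, hx⟩, rfl⟩)

lemma kerCompRangeShortComplex_shortExact : (kerCompRangeShortComplex π w).ShortExact :=
  shortExact_of_pointwise _ (fun _ => Subtype.val_injective)
    (fun c => (toRangeFunctor_surjective w c).comp (hπ c))
    (fun _ x hx => ⟨⟨x, (toRangeFunctor_eq_zero_iff w _).1 hx⟩, rfl⟩)

lemma kerKerShortComplex_shortExact : (kerKerShortComplex π w).ShortExact :=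
  shortExact_of_pointwise _
    (fun c x y h => Subtype.ext
      (congrArg (fun z : LinearMap.ker ((π ≫ w).app c).hom => z.1) h))
    (fun c y => by
      obtain ⟨x, hx⟩ := hπ c y.1
      exact ⟨⟨x, (congrArg (w.app c) hx).trans y.2⟩, Subtype.ext hx⟩)
    (fun _ x hx => ⟨⟨x.1, congrArg Subtype.val hx⟩, Subtype.ext rfl⟩)

end KernelsAndRanges

/-! ### Cycles, boundaries and acyclic subquotients of the cone complex -/

section ConeComplex

variable {R : Type u} [CommRing R] {G' G'' : Type u} [AddCommGroup G'] [Module R G']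
  [AddCommGroup G''] [Module R G''] (β : G' →ₗ[R] G'')

section Elements

variable {C C' : CochainComplex (ModuleCat.{u} R) ℤ}

/-- The first component of a chain of `coneComplex β C`. -/
def coneFst (C : CochainComplex (ModuleCat.{u} R) ℤ) (i : ℤ) :
    (coneComplex β C).X i →ₗ[R] (C.X i →ₗ[R] G') := LinearMap.fst R _ _

/-- The second component of a chain of `coneComplex β C`. -/
def coneSnd (C : CochainComplex (ModuleCat.{u} R) ℤ) (i : ℤ) :
    (coneComplex β C).X i →ₗ[R] (C.X (i + 1) →ₗ[R] G'') := LinearMap.snd R _ _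

/-- The chain of `coneComplex β C` with given components. -/
def coneMk {i : ℤ} (φ : C.X i →ₗ[R] G') (ψ : C.X (i + 1) →ₗ[R] G'') : (coneComplex β C).X i :=
  ((φ, ψ) : (C.X i →ₗ[R] G') × (C.X (i + 1) →ₗ[R] G''))

@[simp]
lemma coneFst_coneMk {i : ℤ} (φ : C.X i →ₗ[R] G') (ψ : C.X (i + 1) →ₗ[R] G'') :
    coneFst β C i (coneMk β φ ψ) = φ := rfl

@[simp]
lemma coneSnd_coneMk {i : ℤ} (φ : C.X i →ₗ[R] G') (ψ : C.X (i + 1) →ₗ[R] G'') :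
    coneSnd β C i (coneMk β φ ψ) = ψ := rfl

variable {β} in
lemma cone_ext {i : ℤ} {x y : (coneComplex β C).X i} (h : coneFst β C i x = coneFst β C i y)
    (h' : coneSnd β C i x = coneSnd β C i y) : x = y := Prod.ext h h'

lemma coneFst_map (f : C ⟶ C') (i : ℤ) (x : (coneComplex β C').X i) :
    coneFst β C i ((coneMap β f).f i x) = coneFst β C' i x ∘ₗ (f.f i).hom := rfl

lemma coneSnd_map (f : C ⟶ C') (i : ℤ) (x : (coneComplex β C').X i) :
    coneSnd β C i ((coneMap β f).f i x) = coneSnd β C' i x ∘ₗ (f.f (i + 1)).hom := rfl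

lemma coneComplex_d (j : ℤ) :
    (coneComplex β C).d (j + 1) j = ModuleCat.ofHom (coneD β C j) := by
  simp only [coneComplex, ChainComplex.of_d]

lemma coneFst_d {i j : ℤ} (hij : j + 1 = i) (y : (coneComplex β C).X i) :
    coneFst β C j ((coneComplex β C).d i j y) = coneFst β C i y ∘ₗ (C.d j i).hom := by
  subst hij
  rw [coneComplex_d]
  rfl

lemma coneSnd_d (j : ℤ) (y : (coneComplex β C).X (j + 1)) :
    coneSnd β C j ((coneComplex β C).d (j + 1) j y) =
      β ∘ₗ coneFst β C (j + 1) y - coneSnd β C (j + 1) y ∘ₗ (C.d (j + 1) (j + 1 + 1)).hom := by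
  rw [coneComplex_d]
  rfl

lemma cone_d_eq_zero_iff {i j : ℤ} (hij : j + 1 = i) (y : (coneComplex β C).X i) :
    (coneComplex β C).d i j y = 0 ↔ (∀ x, coneFst β C i y (C.d j i x) = 0) ∧
      ∀ x, β (coneFst β C i y x) = coneSnd β C i y (C.d i (i + 1) x) := by
  subst hij
  constructor
  · intro h
    constructor
    · intro x
      have := LinearMap.congr_fun (coneFst_d β rfl y) x
      rw [h, map_zero] at this
      exact this.symm
    · intro x
      have := LinearMap.congr_fun (coneSnd_d β j y) x
      rw [h, map_zero] at this
      exact sub_eq_zero.1 this.symm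
  · rintro ⟨h₁, h₂⟩
    refine cone_ext ?_ ?_
    · rw [coneFst_d β rfl, map_zero]
      exact LinearMap.ext h₁
    · rw [coneSnd_d, map_zero]
      exact LinearMap.ext fun x => sub_eq_zero.2 (h₂ x)

end Elements

/-- The chains of `coneComplex β C` as a functor of `C`. -/
def coneX (i : ℤ) : (CochainComplex (ModuleCat.{u} R) ℤ)ᵒᵖ ⥤ ModuleCat.{u} R :=
  coneFunctor β ⋙ HomologicalComplex.eval _ _ i

/-- The cycles of `coneComplex β C` as a functor of `C`. -/
def coneZ (i : ℤ) : (CochainComplex (ModuleCat.{u} R) ℤ)ᵒᵖ ⥤ ModuleCat.{u} R :=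
  coneFunctor β ⋙ HomologicalComplex.cyclesFunctor _ _ i

/-- The inclusion of the cycles. -/
def coneι (i : ℤ) : coneZ β i ⟶ coneX β i where
  app C := (coneComplex β C.unop).iCycles i
  naturality _ _ f := HomologicalComplex.cyclesMap_i (coneMap β f.unop) i

/-- The projection of the cycles to the homology. -/
def coneπ (i : ℤ) : coneZ β i ⟶ barH β i where
  app C := (coneComplex β C.unop).homologyπ i
  naturality _ _ f := (HomologicalComplex.homologyπ_naturality (coneMap β f.unop) i).symm

lemma coneπ_surjective (i : ℤ) (C : (CochainComplex (ModuleCat.{u} R) ℤ)ᵒᵖ) :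
    Function.Surjective ((coneπ β i).app C) := homologyπ_surjective _ _

/-- The boundary map to the boundaries, i.e. to the cycles with zero homology class. -/
def coneBoundary (i j : ℤ) : coneX β i ⟶ kerFunctor (coneπ β j) where
  app C := ModuleCat.ofHom (LinearMap.codRestrict _ ((coneComplex β C.unop).toCycles i j).hom
    fun x => congr($((coneComplex β C.unop).toCycles_comp_homologyπ i j) x))
  naturality C C' f := by
    ext x
    refine Subtype.ext (iCycles_injective (coneComplex β C'.unop) j ?_)
    have h₁ := congr($((coneComplex β C'.unop).toCycles_i i j) ((coneMap β f.unop).f i x))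
    have h₂ := congr((coneMap β f.unop).f j ($((coneComplex β C.unop).toCycles_i i j) x))
    have h₃ := congr($(HomologicalComplex.cyclesMap_i (coneMap β f.unop) j)
      ((coneComplex β C.unop).toCycles i j x))
    have h₄ := congr($((coneMap β f.unop).comm i j) x)
    exact h₁.trans (h₄.trans (h₂.symm.trans h₃.symm))

/-- `0 → Z_i → C_i → B_j → 0`, where `i = j + 1`. -/
def boundaryShortComplex (i j : ℤ) :
    ShortComplex ((CochainComplex (ModuleCat.{u} R) ℤ)ᵒᵖ ⥤ ModuleCat.{u} R) where
  X₁ := coneZ β i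
  X₂ := coneX β i
  X₃ := kerFunctor (coneπ β j)
  f := coneι β i
  g := coneBoundary β i j
  zero := by
    ext C x
    refine Subtype.ext (iCycles_injective (coneComplex β C.unop) j ?_)
    refine congr($((coneComplex β C.unop).toCycles_i i j)
      ((coneComplex β C.unop).iCycles i x)).trans ?_
    exact (d_iCycles_apply _ i j x).trans (map_zero _).symm

lemma coneBoundary_iCycles (i j : ℤ) {C : (CochainComplex (ModuleCat.{u} R) ℤ)ᵒᵖ}
    (x : (coneX β i).obj C) :
    (coneComplex β C.unop).iCycles j ((coneBoundary β i j).app C x).1 =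
      (coneComplex β C.unop).d i j x :=
  congr($((coneComplex β C.unop).toCycles_i i j) x)

lemma boundaryShortComplex_shortExact {i j : ℤ} (hij : j + 1 = i) :
    (boundaryShortComplex β i j).ShortExact := by
  refine shortExact_of_pointwise _ (fun c => iCycles_injective _ _) (fun C y => ?_)
    (fun C x hx => ?_)
  · obtain ⟨x, hx⟩ := (homologyπ_eq_zero_iff (coneComplex β C.unop) i j y.1 (by simp [hij])).1 y.2
    refine ⟨x, Subtype.ext (iCycles_injective _ _ ?_)⟩
    exact (coneBoundary_iCycles β i j x).trans hx
  · refine exists_iCycles_eq _ i j ?_ ?_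
    · simp; omega
    · refine (coneBoundary_iCycles β i j x).symm.trans ?_
      exact (congrArg (fun t => (coneComplex β C.unop).iCycles j t.1) hx).trans (map_zero _)

/-- The functor `C ↦ Hom(Z^i(C), G')`. -/
def homCocycles (G' : Type u) [AddCommGroup G'] [Module R G'] (i : ℤ) :
    (CochainComplex (ModuleCat.{u} R) ℤ)ᵒᵖ ⥤ ModuleCat.{u} R :=
  (HomologicalComplex.cyclesFunctor (ModuleCat.{u} R) (ComplexShape.up ℤ) i).op ⋙ homTo R G'

/-- The restriction of the first component of a cycle to the cocycles of `C`. -/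
def restrictCocycles (i : ℤ) : coneZ β i ⟶ homCocycles G' i where
  app C := ModuleCat.ofHom (LinearMap.lcomp R G' (C.unop.iCycles i).hom ∘ₗ
    coneFst β C.unop i ∘ₗ ((coneComplex β C.unop).iCycles i).hom)
  naturality C C' f := by
    ext z
    refine LinearMap.ext fun x => ?_
    have h₁ := congr(coneFst β C'.unop i
      ($(HomologicalComplex.cyclesMap_i (coneMap β f.unop) i) z) (C'.unop.iCycles i x))
    have h₂ := congr(coneFst β C.unop i ((coneComplex β C.unop).iCycles i z)
      ($(HomologicalComplex.cyclesMap_i f.unop i) x))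
    exact h₁.trans h₂.symm

lemma restrictCocycles_apply (i : ℤ) {C : (CochainComplex (ModuleCat.{u} R) ℤ)ᵒᵖ}
    (z : (coneZ β i).obj C) (x : C.unop.cycles i) :
    (show C.unop.cycles i →ₗ[R] G' from (restrictCocycles β i).app C z) x =
      coneFst β C.unop i ((coneComplex β C.unop).iCycles i z) (C.unop.iCycles i x) := rfl

/-- The first component of a boundary has the form `φ' ∘ δ`, which is zero on cocycles. -/
lemma restrictCocycles_eq_zero (i : ℤ) {C : (CochainComplex (ModuleCat.{u} R) ℤ)ᵒᵖ}
    (z : (coneZ β i).obj C) (hz : (coneπ β i).app C z = 0) :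
    (restrictCocycles β i).app C z = 0 := by
  refine LinearMap.ext fun x => ?_
  obtain ⟨y, hy⟩ := (homologyπ_eq_zero_iff (coneComplex β C.unop) (i + 1) i z (by simp)).1 hz
  refine (restrictCocycles_apply β i z x).trans ?_
  rw [← hy, coneFst_d β rfl]
  exact (congrArg (coneFst β C.unop (i + 1) y) (d_iCycles_apply C.unop i (i + 1) x)).trans
    (map_zero _)

/-- The morphism `H̄_i(C) → Hom(Z^i(C), G')`, whose image is `Hom(H^i(C), ker β)`. -/
def barHToHomCocycles (i : ℤ) : barH β i ⟶ homCocycles G' i where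
  app C := surjDesc ((coneπ β i).app C) (coneπ_surjective β i C) ((restrictCocycles β i).app C)
    (restrictCocycles_eq_zero β i)
  naturality C C' f := by
    ext x
    obtain ⟨z, rfl⟩ := coneπ_surjective β i C x
    have h₁ := natTrans_naturality_apply (coneπ β i) f z
    have h₂ := natTrans_naturality_apply (restrictCocycles β i) f z
    refine (congrArg (surjDesc ((coneπ β i).app C') (coneπ_surjective β i C')
      ((restrictCocycles β i).app C') (restrictCocycles_eq_zero β i)) h₁.symm).trans ?_
    refine (surjDesc_apply _ _ _ _ _).trans (h₂.trans ?_)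
    exact congrArg ((homCocycles G' i).map f) (surjDesc_apply _ _ _ _ _).symm

lemma coneπ_barHToHomCocycles (i : ℤ) :
    coneπ β i ≫ barHToHomCocycles β i = restrictCocycles β i := by
  ext C : 2
  exact comp_surjDesc _ _ _ _

/-- The differential of a cochain complex as a natural transformation. -/
def cochainD (i : ℤ) : HomologicalComplex.eval (ModuleCat.{u} R) (ComplexShape.up ℤ) i ⟶
    HomologicalComplex.eval (ModuleCat.{u} R) (ComplexShape.up ℤ) (i + 1) where
  app C := C.d i (i + 1)
  naturality _ _ f := f.comm i (i + 1)

section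

variable {A B I : Type u} [AddCommGroup A] [Module R A] [AddCommGroup B] [Module R B]
  [AddCommGroup I] [Module R I]

/-- The linear map on the range of `g` induced by a linear map vanishing on the kernel. -/
def rangeDesc (g : A →ₗ[R] B) (φ : A →ₗ[R] I) (h : LinearMap.ker g ≤ LinearMap.ker φ) :
    LinearMap.range g →ₗ[R] I :=
  (LinearMap.ker g).liftQ φ h ∘ₗ g.quotKerEquivRange.symm.toLinearMap

lemma rangeDesc_apply (g : A →ₗ[R] B) (φ : A →ₗ[R] I) (h : LinearMap.ker g ≤ LinearMap.ker φ)
    (a : A) : rangeDesc g φ h (g.rangeRestrict a) = φ a := by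
  have : g.quotKerEquivRange.symm (g.rangeRestrict a) = Submodule.Quotient.mk a := by
    rw [LinearEquiv.symm_apply_eq]
    rfl
  rw [rangeDesc, LinearMap.comp_apply, LinearEquiv.coe_coe, this]
  rfl

lemma range_hom_ext {g : A →ₗ[R] B} {φ ψ : LinearMap.range g →ₗ[R] I}
    (h : ∀ a, φ (g.rangeRestrict a) = ψ (g.rangeRestrict a)) : φ = ψ := by
  refine LinearMap.ext fun x => ?_
  obtain ⟨a, rfl⟩ := g.surjective_rangeRestrict x
  exact h a

/-- `rangeDesc` is linear in the map. -/
def rangeDescₗ {M : Type u} [AddCommGroup M] [Module R M] (g : A →ₗ[R] B) (Φ : M →ₗ[R] A →ₗ[R] I)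
    (h : ∀ m, LinearMap.ker g ≤ LinearMap.ker (Φ m)) : M →ₗ[R] LinearMap.range g →ₗ[R] I where
  toFun m := rangeDesc g (Φ m) (h m)
  map_add' m m' := range_hom_ext fun a => by simp [rangeDesc_apply, -LinearMap.codRestrict_apply]
  map_smul' r m := range_hom_ext fun a => by simp [rangeDesc_apply]

end

/-- The cycles of `coneComplex β C` whose first component vanishes on the cocycles of `C`. -/
abbrev coneW (i : ℤ) : (CochainComplex (ModuleCat.{u} R) ℤ)ᵒᵖ ⥤ ModuleCat.{u} R :=
  kerFunctor (coneπ β i ≫ barHToHomCocycles β i)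

lemma comp_barHToHomCocycles_eq_zero_iff (i : ℤ) {C : (CochainComplex (ModuleCat.{u} R) ℤ)ᵒᵖ}
    (z : (coneZ β i).obj C) : (coneπ β i ≫ barHToHomCocycles β i).app C z = 0 ↔
      ∀ x, C.unop.d i (i + 1) x = 0 →
        coneFst β C.unop i ((coneComplex β C.unop).iCycles i z) x = 0 := by
  rw [coneπ_barHToHomCocycles]
  constructor
  · intro h x hx
    obtain ⟨x, rfl⟩ := exists_iCycles_eq C.unop i (i + 1) (by simp) hx
    exact homTo_congr h x
  · intro h
    exact LinearMap.ext fun x => h _ (d_iCycles_apply _ _ _ x)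

/-- The morphism `W_i(C) → Hom(B^{i+1}(C), G')`. -/
def coneWToHom (i : ℤ) : coneW β i ⟶ (rangeFunctor (cochainD (R := R) i)).op ⋙ homTo R G' where
  app C := ModuleCat.ofHom (rangeDescₗ (C.unop.d i (i + 1)).hom
    (coneFst β C.unop i ∘ₗ ((coneComplex β C.unop).iCycles i).hom ∘ₗ Submodule.subtype _)
    fun w => (comp_barHToHomCocycles_eq_zero_iff β i w.1).1 w.2)
  naturality C C' f := by
    ext w
    refine range_hom_ext fun x => ?_
    refine (rangeDesc_apply _ _ _ x).trans ?_
    have h₁ := congr(coneFst β C'.unop i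
      ($(HomologicalComplex.cyclesMap_i (coneMap β f.unop) i) w.1) x)
    refine h₁.trans ((rangeDesc_apply (C.unop.d i (i + 1)).hom
        (coneFst β C.unop i ((coneComplex β C.unop).iCycles i w.1))
        ((comp_barHToHomCocycles_eq_zero_iff β i w.1).1 w.2) (f.unop.f i x)).symm.trans ?_)
    refine congrArg (rangeDesc (C.unop.d i (i + 1)).hom
        (coneFst β C.unop i ((coneComplex β C.unop).iCycles i w.1))
        ((comp_barHToHomCocycles_eq_zero_iff β i w.1).1 w.2)) (Subtype.ext ?_)
    exact congr($(f.unop.comm i (i + 1)) x)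

lemma coneWToHom_apply (i : ℤ) {C : (CochainComplex (ModuleCat.{u} R) ℤ)ᵒᵖ}
    (w : (coneW β i).obj C) (x : C.unop.X i) :
    (show LinearMap.range (C.unop.d i (i + 1)).hom →ₗ[R] G' from (coneWToHom β i).app C w)
        ((C.unop.d i (i + 1)).hom.rangeRestrict x) =
      coneFst β C.unop i ((coneComplex β C.unop).iCycles i w.1) x :=
  rangeDesc_apply _ _ _ x

/-- The inclusion of `Hom(C^{i+1} / B^{i+1}, G'')` in the chains of `coneComplex β C`. -/
def homOpcyclesToX (C : CochainComplex (ModuleCat.{u} R) ℤ) (i : ℤ) :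
    (homTo R G'').obj (op (C.opcycles (i + 1))) ⟶ (coneComplex β C).X i :=
  ModuleCat.ofHom (LinearMap.inr R _ _ ∘ₗ LinearMap.lcomp R G'' (C.pOpcycles (i + 1)).hom)

lemma homOpcyclesToX_d (C : CochainComplex (ModuleCat.{u} R) ℤ) (i j : ℤ) :
    homOpcyclesToX β C i ≫ (coneComplex β C).d i j = 0 := by
  by_cases hij : j + 1 = i
  · ext θ
    refine (cone_d_eq_zero_iff β hij _).2 ⟨fun x => rfl, fun x => (map_zero β).trans ?_⟩
    refine Eq.symm ((congrArg (show C.opcycles (i + 1) →ₗ[R] G'' from θ)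
      congr($(C.d_pOpcycles i (i + 1)) x)).trans (map_zero _))
  · rw [(coneComplex β C).shape i j (by simpa using hij), comp_zero]

/-- The inclusion of `Hom(C^{i+1} / B^{i+1}, G'')` in the cycles of `coneComplex β C`. -/
def homOpcyclesToZ (C : CochainComplex (ModuleCat.{u} R) ℤ) (i : ℤ) :
    (homTo R G'').obj (op (C.opcycles (i + 1))) ⟶ (coneComplex β C).cycles i :=
  (coneComplex β C).liftCycles (homOpcyclesToX β C i) _ rfl (homOpcyclesToX_d β C i _)

lemma homOpcyclesToZ_iCycles (C : CochainComplex (ModuleCat.{u} R) ℤ) (i : ℤ)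
    (θ : (homTo R G'').obj (op (C.opcycles (i + 1)))) :
    (coneComplex β C).iCycles i (homOpcyclesToZ β C i θ) = homOpcyclesToX β C i θ :=
  congr($((coneComplex β C).liftCycles_i (homOpcyclesToX β C i) _ rfl _) θ)

/-- The inclusion of `Hom(C^{i+1} / B^{i+1}, G'')` in `W_i(C)`. -/
def homOpcyclesToW (i : ℤ) :
    (HomologicalComplex.opcyclesFunctor (ModuleCat.{u} R) (ComplexShape.up ℤ) (i + 1)).op ⋙
      homTo R G'' ⟶ coneW β i where
  app C := ModuleCat.ofHom (LinearMap.codRestrict _ (homOpcyclesToZ β C.unop i).hom fun θ =>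
    (comp_barHToHomCocycles_eq_zero_iff β i _).2 fun x _ =>
      congr(coneFst β C.unop i $(homOpcyclesToZ_iCycles β C.unop i θ) x))
  naturality C C' f := by
    ext θ
    refine Subtype.ext (iCycles_injective (coneComplex β C'.unop) i ?_)
    refine (homOpcyclesToZ_iCycles β C'.unop i _).trans ?_
    have h₁ := congr($(HomologicalComplex.cyclesMap_i (coneMap β f.unop) i)
      (homOpcyclesToZ β C.unop i θ))
    refine Eq.trans ?_ h₁.symm
    refine Eq.trans ?_ (congrArg ((coneMap β f.unop).f i) (homOpcyclesToZ_iCycles β C.unop i θ)).symm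
    refine cone_ext rfl ?_
    refine LinearMap.ext fun x => ?_
    exact congr((show C.unop.opcycles (i + 1) →ₗ[R] G'' from θ)
      ($(HomologicalComplex.p_opcyclesMap f.unop (i + 1)) x))

/-- `0 → Hom(C^{i+1} / B^{i+1}, G'') → W_i(C) → Hom(B^{i+1}(C), G') → 0`. -/
def coneWShortComplex (i : ℤ) :
    ShortComplex ((CochainComplex (ModuleCat.{u} R) ℤ)ᵒᵖ ⥤ ModuleCat.{u} R) where
  X₁ := (HomologicalComplex.opcyclesFunctor (ModuleCat.{u} R) (ComplexShape.up ℤ) (i + 1)).op ⋙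
    homTo R G''
  X₂ := coneW β i
  X₃ := (rangeFunctor (cochainD (R := R) i)).op ⋙ homTo R G'
  f := homOpcyclesToW β i
  g := coneWToHom β i
  zero := by
    ext C θ
    refine range_hom_ext fun x => ?_
    refine (coneWToHom_apply β i _ x).trans ?_
    exact congr(coneFst β C.unop i $(homOpcyclesToZ_iCycles β C.unop i θ) x)

/-- A cycle `(φ', φ'')` lies in `W_i` exactly when `φ'` factors through `δ`, that is, through the
coboundaries `B^{i+1}`. If `φ' = 0`, the cycle condition reduces to `φ'' ∘ δ = 0`, so `φ''` descends
to `C^{i+1} / B^{i+1}`. -/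
lemma coneWShortComplex_shortExact [Module.Injective R G''] (i : ℤ) :
    (coneWShortComplex β i).ShortExact := by
  refine shortExact_of_pointwise _ (fun C θ θ' h => ?_) (fun C ψ => ?_) (fun C w hw => ?_)
  · refine LinearMap.ext fun x => ?_
    obtain ⟨x, rfl⟩ := (ModuleCat.epi_iff_surjective (C.unop.pOpcycles (i + 1))).1 inferInstance x
    have h' := congrArg (fun t : (coneW β i).obj C =>
      coneSnd β C.unop i ((coneComplex β C.unop).iCycles i t.1)) h
    have e (θ : (homTo R G'').obj (op (C.unop.opcycles (i + 1)))) :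
        (show C.unop.opcycles (i + 1) →ₗ[R] G'' from θ) (C.unop.pOpcycles (i + 1) x) =
          coneSnd β C.unop i ((coneComplex β C.unop).iCycles i (homOpcyclesToZ β C.unop i θ)) x :=
      congr(coneSnd β C.unop i $(homOpcyclesToZ_iCycles β C.unop i θ) x).symm
    exact (e θ).trans ((LinearMap.congr_fun h' x).trans (e θ').symm)
  · let d := (C.unop.d i (i + 1)).hom
    let φ : C.unop.X i →ₗ[R] G' :=
      (show LinearMap.range d →ₗ[R] G' from ψ) ∘ₗ d.rangeRestrict
    have hφ (x) (hx : d x = 0) : φ x = 0 :=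
      (congrArg (show LinearMap.range d →ₗ[R] G' from ψ) (Subtype.ext hx)).trans (map_zero _)
    -- Surjectivity: `ψ` determines the first component `φ = ψ ∘ δ`, and injectivity of `G''`
    -- provides a second component `φ'` with `φ' ∘ δ = β ∘ φ`, completing it to a cycle.
    obtain ⟨φ', hφ'⟩ := exists_comp_eq_of_ker_le d (β ∘ₗ φ)
      (fun x hx => (congrArg β (hφ x hx)).trans (map_zero β))
    obtain ⟨z, hz⟩ := exists_iCycles_eq (coneComplex β C.unop) i (i - 1) (x := coneMk β φ φ')
      (by simp) ((cone_d_eq_zero_iff β (by omega) _).2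
        ⟨fun x => hφ _ congr($(C.unop.d_comp_d (i - 1) i (i + 1)) x), fun x => (hφ' x).symm⟩)
    have hz' : coneFst β C.unop i ((coneComplex β C.unop).iCycles i z) = φ := by rw [hz]; rfl
    refine ⟨⟨z, (comp_barHToHomCocycles_eq_zero_iff β i z).2 fun x hx => ?_⟩, ?_⟩
    · rw [hz']
      exact hφ x hx
    · refine range_hom_ext fun x => ?_
      refine (coneWToHom_apply β i _ x).trans ?_
      exact LinearMap.congr_fun hz' x
  · have h₁ : coneFst β C.unop i ((coneComplex β C.unop).iCycles i w.1) = 0 :=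
      LinearMap.ext fun x => (coneWToHom_apply β i w x).symm.trans (homTo_congr hw _)
    have h₂ (x : C.unop.X i) :
        coneSnd β C.unop i ((coneComplex β C.unop).iCycles i w.1) (C.unop.d i (i + 1) x) = 0 := by
      refine (((cone_d_eq_zero_iff β (show i - 1 + 1 = i by omega) _).1
        (d_iCycles_apply (coneComplex β C.unop) i (i - 1) w.1)).2 x).symm.trans ?_
      rw [h₁]
      exact map_zero β
    let θ : C.unop.opcycles (i + 1) ⟶ ModuleCat.of R G'' :=
      C.unop.descOpcycles (ModuleCat.ofHom
        (coneSnd β C.unop i ((coneComplex β C.unop).iCycles i w.1))) i (by simp) (by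
        ext x
        exact h₂ x)
    refine ⟨θ.hom, Subtype.ext (iCycles_injective (coneComplex β C.unop) i ?_)⟩
    refine (homOpcyclesToZ_iCycles β C.unop i θ.hom).trans (cone_ext h₁.symm ?_)
    refine LinearMap.ext fun x => ?_
    exact congr($(C.unop.p_descOpcycles (ModuleCat.ofHom
      (coneSnd β C.unop i ((coneComplex β C.unop).iCycles i w.1))) i (by simp) _) x)

/-- `0 → Hom(C^{i+1}, G'') → C_i → Hom(C^i, G') → 0`. -/
def coneXShortComplex (i : ℤ) :
    ShortComplex ((CochainComplex (ModuleCat.{u} R) ℤ)ᵒᵖ ⥤ ModuleCat.{u} R) where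
  X₁ := (HomologicalComplex.eval (ModuleCat.{u} R) (ComplexShape.up ℤ) (i + 1)).op ⋙ homTo R G''
  X₂ := coneX β i
  X₃ := (HomologicalComplex.eval (ModuleCat.{u} R) (ComplexShape.up ℤ) i).op ⋙ homTo R G'
  f := { app C := ModuleCat.ofHom (LinearMap.inr R (C.unop.X i →ₗ[R] G') _) }
  g := { app C := ModuleCat.ofHom (coneFst β C.unop i) }
  zero := rfl

lemma coneXShortComplex_shortExact (i : ℤ) : (coneXShortComplex β i).ShortExact :=
  shortExact_of_pointwise _ (fun _ _ _ h => congrArg Prod.snd h)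
    (fun _ φ => ⟨coneMk β φ 0, rfl⟩)
    (fun _ x h => ⟨coneSnd β _ i x, cone_ext (β := β) h.symm rfl⟩)

variable {J : Type u} [Preorder J] [IsDirectedOrder J] [Nonempty J]
  [Module.Injective R G'] [Module.Injective R G'']

lemma isAcyclic_coneX (i : ℤ) : IsAcyclic J (coneX β i) :=
  isAcyclic_of_shortExact (S := coneXShortComplex β i) (coneXShortComplex_shortExact β i)
    (isAcyclic_homTo (I := G'') (HomologicalComplex.eval (ModuleCat.{u} R) (ComplexShape.up ℤ) (i + 1)))
    (isAcyclic_homTo (I := G') (HomologicalComplex.eval (ModuleCat.{u} R) (ComplexShape.up ℤ) i))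

/-- The outer terms have the form `Hom(A, I)`. This splits the long exact sequences for cycles,
boundaries and homology into short pieces. -/
lemma isAcyclic_coneW (i : ℤ) : IsAcyclic J (coneW β i) :=
  isAcyclic_of_shortExact (S := coneWShortComplex β i) (coneWShortComplex_shortExact β i)
    (isAcyclic_homTo (I := G'')
      (HomologicalComplex.opcyclesFunctor (ModuleCat.{u} R) (ComplexShape.up ℤ) (i + 1)))
    (isAcyclic_homTo (I := G') (rangeFunctor (cochainD (R := R) i)))

end ConeComplex

/-! ### `Hom` into an injective module along a quasi-isomorphism -/

section QuasiIso

variable {R : Type u} [CommRing R] {E C : CochainComplex (ModuleCat.{u} R) ℤ}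

lemma cochain_map_d (f : E ⟶ C) (i j : ℤ) (x : E.X i) : f.f j (E.d i j x) = C.d i j (f.f i x) :=
  congr($(f.comm i j) x).symm

/-- A cochain map inducing surjections and injections in cohomology, in terms of elements. -/
structure IsElementwiseQuasiIso (f : E ⟶ C) : Prop where
  surjective {i j k : ℤ} (hij : i + 1 = j) (hjk : j + 1 = k) (c : C.X j) (hc : C.d j k c = 0) :
    ∃ (e : E.X j) (b : C.X i), E.d j k e = 0 ∧ c = f.f j e + C.d i j b
  injective {i j k : ℤ} (hij : i + 1 = j) (hjk : j + 1 = k) (e : E.X j) (he : E.d j k e = 0)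
    (b : C.X i) (hb : f.f j e = C.d i j b) : ∃ e' : E.X i, e = E.d i j e'

variable {f : E ⟶ C} (hf : IsElementwiseQuasiIso f) {I : Type u} [AddCommGroup I] [Module R I]
  [Module.Injective R I] {i j k l : ℤ} (hij : i + 1 = j) (hjk : j + 1 = k) (hkl : k + 1 = l)
include hf hij hjk

/-- Injectivity of `f` in cohomology makes `(e, b) ↦ φ e` vanish on the kernel of `(e, b) ↦ (f e + δ
b, δ e)`. It therefore factors through that map, and the two components of the factorization are `ψ`
and `χ`; testing on `(0, b)` shows that `ψ` kills coboundaries. -/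
lemma IsElementwiseQuasiIso.exists_cocycle (φ : E.X j →ₗ[R] I) (hφ : ∀ x, φ (E.d i j x) = 0) :
    ∃ (ψ : C.X j →ₗ[R] I) (χ : E.X k →ₗ[R] I), (∀ x, ψ (C.d i j x) = 0) ∧
      ∀ e, φ e = ψ (f.f j e) + χ (E.d j k e) := by
  let g : (E.X j × C.X i) →ₗ[R] (C.X j × E.X k) :=
    LinearMap.prod ((f.f j).hom.coprod (C.d i j).hom)
      ((E.d j k).hom ∘ₗ LinearMap.fst R _ _)
  obtain ⟨h, hh⟩ := exists_comp_eq_of_ker_le g (φ ∘ₗ LinearMap.fst R _ _) (by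
    rintro ⟨e, b⟩ h
    have h₁ : f.f j e + C.d i j b = 0 := congrArg Prod.fst h
    have h₂ : E.d j k e = 0 := congrArg Prod.snd h
    obtain ⟨e', rfl⟩ := hf.injective hij hjk e h₂ (-b) (by
      rw [map_neg]; exact eq_neg_of_add_eq_zero_left h₁)
    exact hφ e')
  refine ⟨h ∘ₗ LinearMap.inl R _ _, h ∘ₗ LinearMap.inr R _ _, fun x => ?_, fun e => ?_⟩
  · have := hh (0, x)
    simpa [g] using this
  · have := hh (e, 0)
    rw [LinearMap.comp_apply, LinearMap.comp_apply, ← map_add]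
    simpa [g] using this.symm

-- The same argument one step further in the mapping cone of `f`, with `(c, e) ↦ (δ c + f e, δ e)`.
-- On its kernel `e = δ e'` by injectivity in cohomology, and surjectivity writes the cocycle `c + f
-- e'` as `f e₀ + δ b` with `δ e₀ = 0`; the hypotheses then give `ψ c + χ e = 0`.
include hkl in
lemma IsElementwiseQuasiIso.exists_coboundary (ψ : C.X j →ₗ[R] I) (hψ : ∀ x, ψ (C.d i j x) = 0)
    (χ : E.X k →ₗ[R] I) (hχ : ∀ e, ψ (f.f j e) = χ (E.d j k e)) :
    ∃ (ω : C.X k →ₗ[R] I) (ξ : E.X l →ₗ[R] I), (∀ x, ψ x = ω (C.d j k x)) ∧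
      ∀ e, χ e = ω (f.f k e) + ξ (E.d k l e) := by
  let g : (C.X j × E.X k) →ₗ[R] (C.X k × E.X l) :=
    LinearMap.prod ((C.d j k).hom.coprod (f.f k).hom)
      ((E.d k l).hom ∘ₗ LinearMap.snd R _ _)
  obtain ⟨h, hh⟩ := exists_comp_eq_of_ker_le g (ψ.coprod χ) (by
    rintro ⟨c, e⟩ h
    have h₁ : C.d j k c + f.f k e = 0 := congrArg Prod.fst h
    have h₂ : E.d k l e = 0 := congrArg Prod.snd h
    obtain ⟨e', rfl⟩ := hf.injective hjk hkl e h₂ (-c) (by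
      rw [map_neg]; exact eq_neg_of_add_eq_zero_right h₁)
    obtain ⟨e₀, b, he₀, hb⟩ := hf.surjective hij hjk (c + f.f j e') (by
      rw [map_add, ← cochain_map_d]; exact h₁)
    have h₃ := congrArg ψ hb
    rw [map_add, map_add, hψ, hχ, hχ, he₀, map_zero, add_zero] at h₃
    exact h₃)
  refine ⟨h ∘ₗ LinearMap.inl R _ _, h ∘ₗ LinearMap.inr R _ _, fun x => ?_, fun e => ?_⟩
  · have := hh (x, 0)
    simpa [g] using this.symm
  · have := hh (0, e)
    rw [LinearMap.comp_apply, LinearMap.comp_apply, ← map_add]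
    simpa [g] using this.symm

end QuasiIso

/-! ### The cone complex turns quasi-isomorphisms into homology isomorphisms -/

section Cone

variable {R : Type u} [CommRing R] {G' G'' : Type u} [AddCommGroup G'] [Module R G']
  [AddCommGroup G''] [Module R G''] (β : G' →ₗ[R] G'')
  [Module.Injective R G'] [Module.Injective R G'']
  {E C : CochainComplex (ModuleCat.{u} R) ℤ} {f : E ⟶ C}
  (hf : IsElementwiseQuasiIso f)
include hf

/-- Surjectivity in homology. First correct the `G'`-component of `y` to `ψ ∘ f + χ ∘ δ`; then `β ∘
ψ` and the remaining `G''`-component satisfy the hypotheses of `exists_coboundary`, whose `ω`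
completes `ψ` to a cycle. -/
lemma IsElementwiseQuasiIso.exists_cone_cycle {i j : ℤ} (hij : j + 1 = i)
    (y : (coneComplex β E).X i) (hy : (coneComplex β E).d i j y = 0) :
    ∃ (c : (coneComplex β C).X i) (x : (coneComplex β E).X (i + 1)),
      (coneComplex β C).d i j c = 0 ∧
        y = (coneMap β f).f i c + (coneComplex β E).d (i + 1) i x := by
  obtain ⟨h₁, h₂⟩ := (cone_d_eq_zero_iff β hij y).1 hy
  obtain ⟨ψ, χ, hψ, hχ⟩ := hf.exists_cocycle hij rfl _ h₁
  obtain ⟨ω, ξ, hω, hξ⟩ := hf.exists_coboundary hij rfl rfl (β ∘ₗ ψ)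
    (fun x => (congrArg β (hψ x)).trans (map_zero β)) (coneSnd β E i y - β ∘ₗ χ) (fun e => by
      rw [LinearMap.sub_apply, ← h₂, hχ, map_add]
      exact (add_sub_cancel_right _ _).symm)
  -- The sign of `ξ` compensates the minus sign in `∂`: the second component of `∂(χ, -ξ)` is `β ∘ χ
  -- + ξ ∘ δ`.
  refine ⟨coneMk β ψ ω, coneMk β χ (-ξ), (cone_d_eq_zero_iff β hij _).2 ⟨hψ, hω⟩, cone_ext ?_ ?_⟩
  · rw [map_add, coneFst_map, coneFst_d β rfl]
    exact LinearMap.ext hχ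
  · rw [map_add, coneSnd_map, coneSnd_d]
    refine LinearMap.ext fun e => ?_
    have := hξ e
    rw [LinearMap.sub_apply, sub_eq_iff_eq_add] at this
    rw [this]
    simp only [coneFst_coneMk, coneSnd_coneMk, LinearMap.add_apply, LinearMap.sub_apply,
      LinearMap.comp_apply, LinearMap.neg_apply]
    abel

/-- Injectivity in homology, by two uses of `exists_coboundary`: the first bounds the `G'`-component
by `ω`, the second bounds the `G''`-component after `β ∘ ω` has been subtracted. The leftover `ξ` of
the first enters the compatibility needed for the second. -/
lemma IsElementwiseQuasiIso.exists_cone_boundary {i j : ℤ} (hij : j + 1 = i)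
    (c : (coneComplex β C).X i) (hc : (coneComplex β C).d i j c = 0)
    (x : (coneComplex β E).X (i + 1))
    (hx : (coneMap β f).f i c = (coneComplex β E).d (i + 1) i x) :
    ∃ y : (coneComplex β C).X (i + 1), (coneComplex β C).d (i + 1) i y = c := by
  obtain ⟨h₁, h₂⟩ := (cone_d_eq_zero_iff β hij c).1 hc
  have hx₁ := congrArg (coneFst β E i) hx
  have hx₂ := congrArg (coneSnd β E i) hx
  rw [coneFst_map, coneFst_d β rfl] at hx₁
  rw [coneSnd_map, coneSnd_d] at hx₂
  obtain ⟨ω, ξ, hω, hξ⟩ := hf.exists_coboundary hij rfl rfl _ h₁ _ (LinearMap.congr_fun hx₁)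
  obtain ⟨ω', ξ', hω', -⟩ := hf.exists_coboundary (i := i) rfl rfl rfl (coneSnd β C i c - β ∘ₗ ω)
    (fun x => by
      rw [LinearMap.sub_apply, ← h₂, hω]
      exact sub_self _)
    (β ∘ₗ ξ - coneSnd β E (i + 1) x) (fun e => by
      have h₃ := LinearMap.congr_fun hx₂ e
      have h₄ := hξ e
      simp only [LinearMap.sub_apply, LinearMap.comp_apply] at h₃ ⊢
      refine (congrArg (· - _) h₃).trans ?_
      rw [h₄, map_add]
      abel)
  refine ⟨coneMk β ω (-ω'), cone_ext ?_ ?_⟩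
  · rw [coneFst_d β rfl]
    exact LinearMap.ext fun e => (hω e).symm
  · rw [coneSnd_d]
    refine LinearMap.ext fun e => ?_
    have := hω' e
    simp only [coneFst_coneMk, coneSnd_coneMk, LinearMap.sub_apply,
      LinearMap.comp_apply, LinearMap.neg_apply] at this ⊢
    rw [sub_eq_iff_eq_add] at this
    rw [this]
    exact (sub_neg_eq_add _ _).trans (add_comm _ _)

end Cone

/-! ### Directed colimits of cochain complexes and associated systems -/

section Colimit

variable {R : Type u} [CommRing R] {J : Type u} [Preorder J] [IsDirectedOrder J] [Nonempty J]

lemma exists_rep_of_isColimit {F : J ⥤ ModuleCat.{u} R} {c : Cocone F} (hc : IsColimit c)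
    (x : c.pt) : ∃ (a : J) (y : F.obj a), c.ι.app a y = x :=
  Concrete.isColimit_exists_rep F hc x

lemma exists_map_eq_zero_of_isColimit {F : J ⥤ ModuleCat.{u} R} {c : Cocone F} (hc : IsColimit c)
    {a : J} (y : F.obj a) (hy : c.ι.app a y = 0) : ∃ (b : J) (f : a ⟶ b), F.map f y = 0 := by
  obtain ⟨b, f, g, h⟩ := Concrete.isColimit_exists_of_rep_eq F hc y (0 : F.obj a)
    (hy.trans (map_zero _).symm)
  exact ⟨b, f, h.trans (map_zero _)⟩

variable {D : J ⥤ CochainComplex (ModuleCat.{u} R) ℤ}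

lemma colimit_exists_rep (i : ℤ) (x : (colimit D).X i) :
    ∃ (a : J) (y : (D.obj a).X i), (colimit.ι D a).f i y = x :=
  exists_rep_of_isColimit
    (isColimitOfPreserves (HomologicalComplex.eval _ _ i) (colimit.isColimit D)) x

lemma colimit_exists_map_eq_zero (i : ℤ) {a : J} (y : (D.obj a).X i)
    (hy : (colimit.ι D a).f i y = 0) : ∃ (b : J) (f : a ⟶ b), (D.map f).f i y = 0 :=
  exists_map_eq_zero_of_isColimit
    (isColimitOfPreserves (HomologicalComplex.eval _ _ i) (colimit.isColimit D)) y hy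

lemma colimit_glue {I : Type u} [AddCommGroup I] [Module R I] (i : ℤ)
    (ψ : ∀ a, (D.obj a).X i →ₗ[R] I)
    (hψ : ∀ {a b : J} (f : a ⟶ b) (x), ψ b ((D.map f).f i x) = ψ a x) :
    ∃ Ψ : (colimit D).X i →ₗ[R] I, ∀ a x, Ψ ((colimit.ι D a).f i x) = ψ a x := by
  have hc := isColimitOfPreserves (HomologicalComplex.eval _ _ i) (colimit.isColimit D)
  let s : Cocone (D ⋙ HomologicalComplex.eval _ _ i) :=
    { pt := ModuleCat.of R I
      ι := { app a := ModuleCat.ofHom (ψ a)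
             naturality a b f := by
               ext x
               exact hψ f x } }
  exact ⟨(hc.desc s).hom, fun a x => congr($(hc.fac s a) x)⟩

lemma colimit_hom_ext {I : Type u} [AddCommGroup I] [Module R I] {i : ℤ}
    {Ψ Ψ' : (colimit D).X i →ₗ[R] I}
    (h : ∀ a x, Ψ ((colimit.ι D a).f i x) = Ψ' ((colimit.ι D a).f i x)) : Ψ = Ψ' := by
  refine LinearMap.ext fun x => ?_
  obtain ⟨a, y, rfl⟩ := colimit_exists_rep i x
  exact h a y

variable {C : CochainComplex (ModuleCat.{u} R) ℤ} {φ : D ⟶ (Functor.const J).obj C}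

/-- The cochain map from the colimit of a direct system associated with `C` is a
quasi-isomorphism. -/
lemma IsAssociated.isElementwiseQuasiIso (hφ : IsAssociated φ) :
    IsElementwiseQuasiIso (colimit.desc D (Cocone.mk C φ)) := by
  have hι (a : J) (i : ℤ) (x : (D.obj a).X i) :
      (colimit.desc D (Cocone.mk C φ)).f i ((colimit.ι D a).f i x) = (φ.app a).f i x :=
    congr(HomologicalComplex.Hom.f $(colimit.ι_desc (Cocone.mk C φ) a) i x)
  have hbij (i : ℤ) := (ConcreteCategory.isIso_iff_bijective _).1 (hφ i)
  have hdesc (a : J) (i : ℤ) (s : (D.obj a).homology i) :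
      colimit.desc (D ⋙ HomologicalComplex.homologyFunctor _ _ i)
        ((HomologicalComplex.homologyFunctor _ _ i).mapCocone (Cocone.mk C φ))
        (colimit.ι (D ⋙ HomologicalComplex.homologyFunctor _ _ i) a s) =
      HomologicalComplex.homologyMap (φ.app a) i s :=
    congr($(colimit.ι_desc ((HomologicalComplex.homologyFunctor _ _ i).mapCocone
      (Cocone.mk C φ)) a) s)
  constructor
  · intro i j k hij hjk c hc
    obtain ⟨z, rfl⟩ := exists_iCycles_eq C j k (by simp [hjk]) hc
    -- The class of `c` comes from the colimit of cohomologies, hence from a cocycle at a single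
    -- stage `a`; the two differ by a coboundary in `C`.
    obtain ⟨t, ht⟩ := (hbij j).2 (C.homologyπ j z)
    obtain ⟨a, s, rfl⟩ := exists_rep_of_isColimit (colimit.isColimit _) t
    obtain ⟨w, rfl⟩ := homologyπ_surjective _ _ s
    have h : C.homologyπ j (HomologicalComplex.cyclesMap (φ.app a) j w) = C.homologyπ j z := by
      refine Eq.trans ?_ ((hdesc a j _).symm.trans ht)
      exact congr($(HomologicalComplex.homologyπ_naturality (φ.app a) j) w).symm
    rw [← sub_eq_zero, ← map_sub, homologyπ_eq_zero_iff C i j _ (by simp; omega)] at h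
    obtain ⟨y, hy⟩ := h
    refine ⟨(colimit.ι D a).f j ((D.obj a).iCycles j w), -y, ?_, ?_⟩
    · rw [← cochain_map_d, d_iCycles_apply, map_zero]
    · rw [hι, map_neg, hy, map_sub]
      have : C.iCycles j (HomologicalComplex.cyclesMap (φ.app a) j w) =
        (φ.app a).f j ((D.obj a).iCycles j w) :=
        congr($(HomologicalComplex.cyclesMap_i (φ.app a) j) w)
      rw [this, neg_sub]
      exact (add_sub_cancel _ _).symm
  · intro i j k hij hjk e he b hb
    obtain ⟨a, d, rfl⟩ := colimit_exists_rep j e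
    rw [← cochain_map_d] at he
    -- A representative of `e` need not be a cocycle at stage `a`, but it becomes one at a later
    -- stage `a'`. Its class vanishes in `H^j(C)`, so by association it vanishes in the colimit,
    -- hence at some still later stage `a''`.
    obtain ⟨a', f, hd⟩ := colimit_exists_map_eq_zero k _ he
    rw [cochain_map_d] at hd
    obtain ⟨w, hw⟩ := exists_iCycles_eq (D.obj a') j k (by simp [hjk]) hd
    have hιf {a a' : J} (f : a ⟶ a') (i : ℤ) (d : (D.obj a).X i) :
        (colimit.ι D a').f i ((D.map f).f i d) = (colimit.ι D a).f i d :=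
      congr(HomologicalComplex.Hom.f $(colimit.w D f) i d)
    rw [← hιf f j d] at hb ⊢
    rw [hι, ← hw] at hb
    have h₀ : C.homologyπ j (HomologicalComplex.cyclesMap (φ.app a') j w) = 0 := by
      rw [homologyπ_eq_zero_iff C i j _ (by simp; omega)]
      refine ⟨b, hb.symm.trans ?_⟩
      exact congr($(HomologicalComplex.cyclesMap_i (φ.app a') j) w).symm
    have h₁ : colimit.ι (D ⋙ HomologicalComplex.homologyFunctor _ _ j) a'
        ((D.obj a').homologyπ j w) = 0 := by
      refine (hbij j).1 (((hdesc a' j _).trans ?_).trans (map_zero _).symm)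
      refine Eq.trans ?_ h₀
      exact congr($(HomologicalComplex.homologyπ_naturality (φ.app a') j) w)
    obtain ⟨a'', g, hg⟩ := exists_map_eq_zero_of_isColimit (colimit.isColimit _) _ h₁
    have h₂ : (D.obj a'').homologyπ j (HomologicalComplex.cyclesMap (D.map g) j w) = 0 := by
      refine Eq.trans ?_ hg
      exact congr($(HomologicalComplex.homologyπ_naturality (D.map g) j) w).symm
    rw [homologyπ_eq_zero_iff (D.obj a'') i j _ (by simp; omega)] at h₂
    obtain ⟨y, hy⟩ := h₂
    refine ⟨(colimit.ι D a'').f i y, ?_⟩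
    rw [← cochain_map_d, hy, ← hw, ← hιf g]
    exact congr((colimit.ι D a'').f j ($(HomologicalComplex.cyclesMap_i (D.map g) j) w)).symm

end Colimit

/-! ### Degree zero: compatible families and the canonical map from `E(C)` -/

section ExtZero

variable {R : Type u} [CommRing R] {J : Type u} [Preorder J] {𝒞 : Type (u + 1)} [Category.{u} 𝒞]
  (E : 𝒞ᵒᵖ ⥤ ModuleCat.{u} R)

/-- The natural isomorphism between the limit of `E(D)` and `extSystem J E 0`. -/
def limSystemIso (J : Type u) [Preorder J] (E : 𝒞ᵒᵖ ⥤ ModuleCat.{u} R) :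
    inverseSystem J E ⋙ lim ≅ extSystem J E 0 :=
  Functor.isoWhiskerLeft _ (limIso R Jᵒᵖ)

/-- The functoriality of the limit of `E(D)` in `E`. -/
def limSystemMap {E E' : 𝒞ᵒᵖ ⥤ ModuleCat.{u} R} (η : E ⟶ E') :
    inverseSystem J E ⋙ lim ⟶ inverseSystem J E' ⋙ lim :=
  Functor.whiskerRight (Functor.whiskerLeft _ ((Functor.whiskeringRight Jᵒᵖ _ _).map η)) _

lemma limSystemIso_naturality {E E' : 𝒞ᵒᵖ ⥤ ModuleCat.{u} R} (η : E ⟶ E') (D : (J ⥤ 𝒞)ᵒᵖ)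
    (x : (inverseSystem J E ⋙ lim).obj D) :
    (limSystemIso J E').hom.app D ((limSystemMap η).app D x) =
      (extSystemMap J η 0).app D ((limSystemIso J E).hom.app D x) :=
  congr($((limIso R Jᵒᵖ).hom.naturality
    (((Functor.whiskeringRight Jᵒᵖ _ _).map η).app ((Functor.opHom J 𝒞).obj D))) x)

/-- The components of an element of `extSystem J E 0`. -/
def extEval (D : J ⥤ 𝒞) (a : J) : (extSystem J E 0).obj (op D) ⟶ E.obj (op (D.obj a)) :=
  (limSystemIso J E).inv.app (op D) ≫ limit.π ((inverseSystem J E).obj (op D)) (op a)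

variable {D D' : J ⥤ 𝒞}

lemma extEval_limSystemIso (a : J) (x : (inverseSystem J E ⋙ lim).obj (op D)) :
    extEval E D a ((limSystemIso J E).hom.app (op D) x) =
      limit.π ((inverseSystem J E).obj (op D)) (op a) x :=
  congr(limit.π ((inverseSystem J E).obj (op D)) (op a)
    ($((limSystemIso J E).hom_inv_id_app (op D)) x))

lemma limSystemIso_surjective (D : (J ⥤ 𝒞)ᵒᵖ) :
    Function.Surjective ((limSystemIso J E).hom.app D) := fun x =>
  ⟨(limSystemIso J E).inv.app D x, congr($((limSystemIso J E).inv_hom_id_app D) x)⟩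

variable {E}

lemma ext_zero_ext {x y : (extSystem J E 0).obj (op D)}
    (h : ∀ a, extEval E D a x = extEval E D a y) : x = y := by
  obtain ⟨x, rfl⟩ := limSystemIso_surjective E _ x
  obtain ⟨y, rfl⟩ := limSystemIso_surjective E _ y
  refine congrArg _ (Concrete.limit_ext ((inverseSystem J E).obj (op D)) x y fun a => ?_)
  exact (extEval_limSystemIso E a.unop x).symm.trans
    ((h a.unop).trans (extEval_limSystemIso E a.unop y))

lemma extEval_map {a b : J} (f : a ⟶ b) (x : (extSystem J E 0).obj (op D)) :
    E.map (D.map f).op (extEval E D b x) = extEval E D a x := by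
  obtain ⟨x, rfl⟩ := limSystemIso_surjective E _ x
  rw [extEval_limSystemIso, extEval_limSystemIso]
  exact congr($(limit.w ((inverseSystem J E).obj (op D)) f.op) x)

lemma extEval_extSystemMap {E' : 𝒞ᵒᵖ ⥤ ModuleCat.{u} R} (η : E ⟶ E') (a : J)
    (x : (extSystem J E 0).obj (op D)) :
    extEval E' D a ((extSystemMap J η 0).app (op D) x) =
      η.app (op (D.obj a)) (extEval E D a x) := by
  obtain ⟨x, rfl⟩ := limSystemIso_surjective E _ x
  rw [← limSystemIso_naturality, extEval_limSystemIso, extEval_limSystemIso]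
  exact congr($(limMap_π (((Functor.whiskeringRight Jᵒᵖ _ _).map η).app
    ((Functor.opHom J 𝒞).obj (op D))) (op a)) x)

lemma extEval_map_op (f : D ⟶ D') (a : J) (x : (extSystem J E 0).obj (op D')) :
    extEval E D a ((extSystem J E 0).map f.op x) = E.map (f.app a).op (extEval E D' a x) := by
  obtain ⟨x, rfl⟩ := limSystemIso_surjective E _ x
  have h := natTrans_naturality_apply (limSystemIso J E).hom f.op x
  rw [← h, extEval_limSystemIso, extEval_limSystemIso]
  exact congr($(limMap_π ((inverseSystem J E).map f.op) (op a)) x)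

variable {C C' : 𝒞} (φ : D ⟶ (Functor.const J).obj C) (φ' : D' ⟶ (Functor.const J).obj C')

lemma const_naturality {a b : J} (f : a ⟶ b) : D.map f ≫ φ.app b = φ.app a :=
  (φ.naturality f).trans (Category.comp_id _)

variable (E) in
/-- The cone of `E(D)` induced by a natural transformation to a constant functor. -/
def systemCone : Cone ((inverseSystem J E).obj (op D)) where
  pt := E.obj (op C)
  π := { app a := E.map (φ.app a.unop).op
         naturality a b f := by
           refine (Category.id_comp _).trans ?_
           refine Eq.trans ?_ (E.map_comp (φ.app a.unop).op (D.map f.unop).op)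
           exact congrArg (fun t => E.map t.op) (const_naturality φ f.unop).symm }

variable (E) in
/-- The canonical map from `E(C)` to the limit of `E(D)`. -/
def toLimSystem : E.obj (op C) ⟶ (inverseSystem J E ⋙ lim).obj (op D) :=
  limit.lift _ (systemCone E φ)

variable (E) in
/-- The canonical map from `E(C)` to `extSystem J E 0`. -/
def toExtSystem : E.obj (op C) ⟶ (extSystem J E 0).obj (op D) :=
  toLimSystem E φ ≫ (limSystemIso J E).hom.app (op D)

lemma extEval_toExtSystem (a : J) (x : E.obj (op C)) :
    extEval E D a (toExtSystem E φ x) = E.map (φ.app a).op x :=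
  (extEval_limSystemIso E a _).trans congr($(limit.lift_π (systemCone E φ) (op a)) x)

lemma extSystemMap_toExtSystem {E' : 𝒞ᵒᵖ ⥤ ModuleCat.{u} R} (η : E ⟶ E') (x : E.obj (op C)) :
    (extSystemMap J η 0).app (op D) (toExtSystem E φ x) = toExtSystem E' φ (η.app (op C) x) :=
  ext_zero_ext fun a => by
    rw [extEval_extSystemMap, extEval_toExtSystem, extEval_toExtSystem,
      natTrans_naturality_apply]
    rfl

lemma extSystem_map_toExtSystem (f : D ⟶ D') (g : C ⟶ C')
    (h : φ ≫ (Functor.const J).map g = f ≫ φ') (x : E.obj (op C')) :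
    (extSystem J E 0).map f.op (toExtSystem E φ' x) = toExtSystem E φ (E.map g.op x) :=
  ext_zero_ext fun a => by
    rw [extEval_map_op, extEval_toExtSystem, extEval_toExtSystem]
    have h₁ : φ.app a ≫ g = f.app a ≫ φ'.app a := congr_app h a
    refine (congr($(E.map_comp (φ'.app a).op (f.app a).op) x)).symm.trans
      (Eq.trans ?_ congr($(E.map_comp g.op (φ.app a).op) x))
    exact congr(E.map (Quiver.Hom.op $h₁) x).symm

end ExtZero

/-! ### Comparing compatible families of cycles with `H̄_j(C; G)` -/

section Comparison

variable {R : Type u} [CommRing R] {G' G'' : Type u} [AddCommGroup G'] [Module R G']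
  [AddCommGroup G''] [Module R G''] (β : G' →ₗ[R] G'')
  {J : Type u} [Preorder J] [IsDirectedOrder J] [Nonempty J]
  {D D' : J ⥤ CochainComplex (ModuleCat.{u} R) ℤ} {C C' : CochainComplex (ModuleCat.{u} R) ℤ}

variable (D) in
/-- The morphism from a direct system to the constant system at its colimit. -/
abbrev toColimit : D ⟶ (Functor.const J).obj (colimit D) := (colimit.cocone D).ι

/-- `Hom` turns the colimit into a limit, so each component of a compatible family of chains glues.
-/
lemma exists_coneMap_ι_eq {i : ℤ} (x : (extSystem J (coneX β i) 0).obj (op D)) :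
    ∃ y : (coneComplex β (colimit D)).X i,
      ∀ a, (coneMap β (colimit.ι D a)).f i y = extEval (coneX β i) D a x := by
  have hx {a b : J} (f : a ⟶ b) := extEval_map (E := coneX β i) (D := D) f x
  obtain ⟨Φ, hΦ⟩ := colimit_glue (D := D) (I := G') i
    (fun a => coneFst β (D.obj a) i (extEval (coneX β i) D a x))
    (fun {a b} f y => congr(coneFst β (D.obj a) i $(hx f) y))
  obtain ⟨Ψ, hΨ⟩ := colimit_glue (D := D) (I := G'') (i + 1)
    (fun a => coneSnd β (D.obj a) i (extEval (coneX β i) D a x))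
    (fun {a b} f y => congr(coneSnd β (D.obj a) i $(hx f) y))
  exact ⟨coneMk β Φ Ψ, fun a => cone_ext (β := β) (LinearMap.ext (hΦ a)) (LinearMap.ext (hΨ a))⟩

variable {β} in
lemma coneMap_ι_ext {i : ℤ} {x y : (coneComplex β (colimit D)).X i}
    (h : ∀ a, (coneMap β (colimit.ι D a)).f i x = (coneMap β (colimit.ι D a)).f i y) : x = y :=
  cone_ext (colimit_hom_ext fun a z => congr(coneFst β (D.obj a) i $(h a) z))
    (colimit_hom_ext fun a z => congr(coneSnd β (D.obj a) i $(h a) z))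

lemma coneMap_ι_desc (φ : D ⟶ (Functor.const J).obj C) (i : ℤ) (a : J)
    (c : (coneComplex β C).X i) :
    (coneMap β (colimit.ι D a)).f i ((coneMap β (colimit.desc D (Cocone.mk C φ))).f i c) =
      (coneMap β (φ.app a)).f i c := by
  have h : coneMap β (colimit.desc D (Cocone.mk C φ)) ≫ coneMap β (colimit.ι D a) =
      coneMap β (φ.app a) :=
    ((coneFunctor β).map_comp (colimit.desc D (Cocone.mk C φ)).op (colimit.ι D a).op).symm.trans
      congr((coneFunctor β).map (Quiver.Hom.op $(colimit.ι_desc (Cocone.mk C φ) a)))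
  exact congr(HomologicalComplex.Hom.f $h i c)

/-- The differential of `coneComplex β C` with values in the cycles. -/
def coneToCycles (i j : ℤ) : coneX β i ⟶ coneZ β j := coneBoundary β i j ≫ kerFunctorι _

lemma coneToCycles_iCycles (i j : ℤ) {C : (CochainComplex (ModuleCat.{u} R) ℤ)ᵒᵖ}
    (x : (coneX β i).obj C) :
    (coneComplex β C.unop).iCycles j ((coneToCycles β i j).app C x) =
      (coneComplex β C.unop).d i j x :=
  coneBoundary_iCycles β i j x

lemma coneMap_d {C C' : CochainComplex (ModuleCat.{u} R) ℤ} (f : C ⟶ C') (i j : ℤ)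
    (x : (coneComplex β C').X i) :
    (coneMap β f).f j ((coneComplex β C').d i j x) =
      (coneComplex β C).d i j ((coneMap β f).f i x) :=
  congr($((coneMap β f).comm i j) x).symm

variable {β} in
lemma coneZ_ext_zero {i : ℤ} {x y : (extSystem J (coneZ β i) 0).obj (op D)}
    (h : ∀ a, (coneComplex β (D.obj a)).iCycles i (extEval (coneZ β i) D a x) =
      (coneComplex β (D.obj a)).iCycles i (extEval (coneZ β i) D a y)) : x = y :=
  ext_zero_ext fun a => iCycles_injective _ _ (h a)

/-- The element of `extSystem J (coneZ β j) 0` given by a cycle of `coneComplex β C` and a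
compatible family of boundaries. -/
def toExtSystemAdd (φ : D ⟶ (Functor.const J).obj C) (i j : ℤ) :
    ModuleCat.of R ((coneZ β j).obj (op C) × (extSystem J (coneX β i) 0).obj (op D)) ⟶
      (extSystem J (coneZ β j) 0).obj (op D) :=
  ModuleCat.ofHom ((toExtSystem (coneZ β j) φ).hom.coprod
    ((extSystemMap J (coneToCycles β i j) 0).app (op D)).hom)

lemma toExtSystemAdd_apply (φ : D ⟶ (Functor.const J).obj C) (i j : ℤ)
    (c : (coneZ β j).obj (op C)) (x : (extSystem J (coneX β i) 0).obj (op D)) :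
    toExtSystemAdd β φ i j (c, x) =
      toExtSystem (coneZ β j) φ c + (extSystemMap J (coneToCycles β i j) 0).app (op D) x := rfl

lemma iCycles_extEval_toExtSystemAdd (φ : D ⟶ (Functor.const J).obj C) (i j : ℤ)
    (c : (coneZ β j).obj (op C)) (x : (extSystem J (coneX β i) 0).obj (op D)) (a : J) :
    (coneComplex β (D.obj a)).iCycles j
      (extEval (coneZ β j) D a (toExtSystemAdd β φ i j (c, x))) =
      (coneMap β (φ.app a)).f j ((coneComplex β C).iCycles j c) +
        (coneComplex β (D.obj a)).d i j (extEval (coneX β i) D a x) := by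
  have h₁ := extEval_toExtSystem (E := coneZ β j) φ a c
  have h₂ := extEval_extSystemMap (coneToCycles β i j) a x
  have h₃ : (coneComplex β (D.obj a)).iCycles j ((coneZ β j).map (φ.app a).op c) =
      (coneMap β (φ.app a)).f j ((coneComplex β C).iCycles j c) :=
    congr($(HomologicalComplex.cyclesMap_i (coneMap β (φ.app a)) j) c)
  have h₄ := coneToCycles_iCycles β i j (extEval (coneX β i) D a x)
  rw [toExtSystemAdd_apply, map_add, h₁, h₂]
  refine (map_add ((coneComplex β (D.obj a)).iCycles j).hom _ _).trans ?_
  exact congr($h₃ + $h₄)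

variable [Module.Injective R G'] [Module.Injective R G'']
  {φ : D ⟶ (Functor.const J).obj C} {φ' : D' ⟶ (Functor.const J).obj C'}

/-- A compatible family of cycles glues to a cycle on `colim D`, which by the quasi-isomorphism is a
cycle of `C` plus a boundary; restrict both to each stage. -/
lemma IsAssociated.toExtSystemAdd_surjective (hφ : IsAssociated φ) {i j : ℤ} (hij : j + 1 = i) :
    Function.Surjective (toExtSystemAdd β φ i j) := by
  intro z
  subst hij
  obtain ⟨y, hy⟩ := exists_coneMap_ι_eq β ((extSystemMap J (coneι β j) 0).app (op D) z)
  have hya (a : J) : (coneMap β (colimit.ι D a)).f j y =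
      (coneComplex β (D.obj a)).iCycles j (extEval (coneZ β j) D a z) :=
    (hy a).trans (extEval_extSystemMap (coneι β j) a z)
  have hdy : (coneComplex β (colimit D)).d j (j - 1) y = 0 := coneMap_ι_ext fun a => by
    rw [map_zero, coneMap_d, hya]
    exact d_iCycles_apply _ _ _ _
  obtain ⟨c, x, hc, hyx⟩ :=
    hφ.isElementwiseQuasiIso.exists_cone_cycle β (show j - 1 + 1 = j by omega) y hdy
  obtain ⟨c, rfl⟩ := exists_iCycles_eq (coneComplex β C) j (j - 1) (by simp) hc
  refine ⟨(c, toExtSystem (coneX β (j + 1)) (toColimit D) x), coneZ_ext_zero fun a => ?_⟩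
  refine (iCycles_extEval_toExtSystemAdd β φ (j + 1) j c _ a).trans (Eq.trans ?_ (hya a))
  rw [hyx, map_add, coneMap_ι_desc, coneMap_d]
  exact congr(_ + (coneComplex β (D.obj a)).d (j + 1) j
    $(extEval_toExtSystem (E := coneX β (j + 1)) (toColimit D) a x))

/-- The family `x` glues to a chain on `colim D` whose negative bounds the pullback of `c`, so `c`
itself bounds. This makes the comparison map well defined. -/
lemma IsAssociated.coneπ_eq_zero (hφ : IsAssociated φ) {i j : ℤ} (hij : j + 1 = i)
    (c : (coneZ β j).obj (op C)) (x : (extSystem J (coneX β i) 0).obj (op D))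
    (h : toExtSystemAdd β φ i j (c, x) = 0) : (coneπ β j).app (op C) c = 0 := by
  subst hij
  obtain ⟨y, hy⟩ := exists_coneMap_ι_eq β x
  have hc : (coneMap β (colimit.desc D (Cocone.mk C φ))).f j ((coneComplex β C).iCycles j c) =
      (coneComplex β (colimit D)).d (j + 1) j (-y) := coneMap_ι_ext fun a => by
    have h' := iCycles_extEval_toExtSystemAdd β φ (j + 1) j c x a
    rw [h, map_zero, ← hy] at h'
    rw [map_neg, map_neg, coneMap_ι_desc, coneMap_d, eq_neg_iff_add_eq_zero]
    exact h'.symm.trans (map_zero _)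
  exact (homologyπ_eq_zero_iff _ _ _ c (by simp)).2
    (hφ.isElementwiseQuasiIso.exists_cone_boundary β (show j - 1 + 1 = j by omega) _
      (d_iCycles_apply _ _ _ c) _ hc)

/-- The comparison homomorphism from compatible families of cycles to `H̄_j(C; G)`. -/
def IsAssociated.comparison (hφ : IsAssociated φ) {i j : ℤ} (hij : j + 1 = i) :
    (extSystem J (coneZ β j) 0).obj (op D) ⟶ (barH β j).obj (op C) :=
  surjDesc (toExtSystemAdd β φ i j) (hφ.toExtSystemAdd_surjective β hij)
    (ModuleCat.ofHom (((coneπ β j).app (op C)).hom ∘ₗ LinearMap.fst R _ _))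
    (fun x hx => hφ.coneπ_eq_zero β hij x.1 x.2 hx)

lemma IsAssociated.comparison_apply (hφ : IsAssociated φ) {i j : ℤ} (hij : j + 1 = i)
    (c : (coneZ β j).obj (op C)) (x : (extSystem J (coneX β i) 0).obj (op D)) :
    hφ.comparison β hij (toExtSystemAdd β φ i j (c, x)) = (coneπ β j).app (op C) c :=
  surjDesc_apply _ _ _ _ _

lemma IsAssociated.comparison_surjective (hφ : IsAssociated φ) {i j : ℤ} (hij : j + 1 = i) :
    Function.Surjective (hφ.comparison β hij) := fun y => by
  obtain ⟨c, rfl⟩ := coneπ_surjective β j (op C) y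
  exact ⟨_, hφ.comparison_apply β hij c 0⟩

lemma IsAssociated.comparison_coneToCycles (hφ : IsAssociated φ) {i j : ℤ} (hij : j + 1 = i)
    (x : (extSystem J (coneX β i) 0).obj (op D)) :
    hφ.comparison β hij ((extSystemMap J (coneToCycles β i j) 0).app (op D) x) = 0 := by
  have h := hφ.comparison_apply β hij 0 x
  rw [toExtSystemAdd_apply, map_zero, map_zero, zero_add] at h
  exact h

/-- Write `z` as a cycle `c` of `C` plus the boundary of a family `x`. If `c = ∂ y`, then `y` can be
absorbed into `x`. -/
lemma IsAssociated.exists_coneToCycles_eq (hφ : IsAssociated φ) {i j : ℤ} (hij : j + 1 = i)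
    (z : (extSystem J (coneZ β j) 0).obj (op D)) (hz : hφ.comparison β hij z = 0) :
    ∃ x : (extSystem J (coneX β i) 0).obj (op D),
      (extSystemMap J (coneToCycles β i j) 0).app (op D) x = z := by
  obtain ⟨⟨c, x⟩, rfl⟩ := hφ.toExtSystemAdd_surjective β hij z
  rw [hφ.comparison_apply] at hz
  obtain ⟨y, hy⟩ := (boundaryShortComplex_shortExact β hij |> fun h =>
    shortExact_app_surjective h (op C)) ⟨c, hz⟩
  refine ⟨toExtSystem (coneX β i) φ y + x, ?_⟩
  have h₁ := extSystemMap_toExtSystem φ (coneToCycles β i j) y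
  rw [map_add, h₁, toExtSystemAdd_apply]
  exact congr(toExtSystem (coneZ β j) φ (Subtype.val $hy) + _)

lemma coneπ_toExtSystemAdd (φ : D ⟶ (Functor.const J).obj C) (i j : ℤ)
    (c : (coneZ β j).obj (op C)) (x : (extSystem J (coneX β i) 0).obj (op D)) :
    (extSystemMap J (coneπ β j) 0).app (op D) (toExtSystemAdd β φ i j (c, x)) =
      toExtSystem (barH β j) φ ((coneπ β j).app (op C) c) := by
  have h₁ := extSystemMap_toExtSystem φ (coneπ β j) c
  have h₂ : (extSystemMap J (coneπ β j) 0).app (op D)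
      ((extSystemMap J (coneToCycles β i j) 0).app (op D) x) = 0 := ext_zero_ext fun a => by
    rw [extEval_extSystemMap, extEval_extSystemMap, map_zero]
    exact ((coneBoundary β i j).app _ (extEval _ _ a x)).2
  rw [toExtSystemAdd_apply, map_add, h₁, h₂, add_zero]

lemma IsAssociated.toExtSystem_comparison (hφ : IsAssociated φ) {i j : ℤ} (hij : j + 1 = i)
    (z : (extSystem J (coneZ β j) 0).obj (op D)) :
    toExtSystem (barH β j) φ (hφ.comparison β hij z) =
      (extSystemMap J (coneπ β j) 0).app (op D) z := by
  obtain ⟨⟨c, x⟩, rfl⟩ := hφ.toExtSystemAdd_surjective β hij z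
  rw [hφ.comparison_apply, coneπ_toExtSystemAdd]

lemma IsAssociated.comparison_naturality (hφ : IsAssociated φ) (hφ' : IsAssociated φ') {i j : ℤ}
    (hij : j + 1 = i) (f : D ⟶ D') (g : C ⟶ C') (h : φ ≫ (Functor.const J).map g = f ≫ φ')
    (z : (extSystem J (coneZ β j) 0).obj (op D')) :
    hφ.comparison β hij ((extSystem J (coneZ β j) 0).map f.op z) =
      (barH β j).map g.op (hφ'.comparison β hij z) := by
  obtain ⟨⟨c, x⟩, rfl⟩ := hφ'.toExtSystemAdd_surjective β hij z
  have h₁ := extSystem_map_toExtSystem (E := coneZ β j) φ φ' f g h c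
  have h₂ := natTrans_naturality_apply (extSystemMap J (coneToCycles β i j) 0) f.op x
  rw [hφ'.comparison_apply, toExtSystemAdd_apply, map_add, h₁, ← h₂]
  refine (hφ.comparison_apply β hij _ _).trans ?_
  exact natTrans_naturality_apply (coneπ β j) g.op c

end Comparison

/-! ### Inverting pointwise bijective transformations -/

section NatTransInv

variable {R : Type u} [CommRing R] {𝒞 : Type*} [Category 𝒞] {E F : 𝒞 ⥤ ModuleCat.{u} R}

/-- The inverse of a pointwise bijective morphism of module-valued functors. -/
def natTransInv (η : E ⟶ F) (h : ∀ c, Function.Bijective (η.app c)) : F ⟶ E :=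
  have (c : 𝒞) : IsIso (η.app c) := (ConcreteCategory.isIso_iff_bijective _).2 (h c)
  have : IsIso η := NatIso.isIso_of_isIso_app η
  inv η

lemma app_natTransInv (η : E ⟶ F) (h : ∀ c, Function.Bijective (η.app c)) (c : 𝒞) (y : F.obj c) :
    η.app c ((natTransInv η h).app c y) = y := by
  have (c : 𝒞) : IsIso (η.app c) := (ConcreteCategory.isIso_iff_bijective _).2 (h c)
  have : IsIso η := NatIso.isIso_of_isIso_app η
  exact congr($(congr_app (IsIso.inv_hom_id η) c) y)

lemma natTransInv_app (η : E ⟶ F) (h : ∀ c, Function.Bijective (η.app c)) (c : 𝒞) (x : E.obj c) :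
    (natTransInv η h).app c (η.app c x) = x :=
  (h c).1 (app_natTransInv η h c _)

lemma natTransInv_bijective (η : E ⟶ F) (h : ∀ c, Function.Bijective (η.app c)) (c : 𝒞) :
    Function.Bijective ((natTransInv η h).app c) :=
  Function.bijective_iff_has_inverse.2 ⟨η.app c, app_natTransInv η h c, natTransInv_app η h c⟩

end NatTransInv

section

variable {R : Type u} [CommRing R] {J : Type u} [Preorder J] {𝒞 : Type (u + 1)} [Category.{u} 𝒞]
  {E H V : 𝒞ᵒᵖ ⥤ ModuleCat.{u} R}

lemma extSystemMap_comp_apply (η : E ⟶ H) (θ : H ⟶ V) {D : (J ⥤ 𝒞)ᵒᵖ} {p : ℕ}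
    (x : (extSystem J E p).obj D) : (extSystemMap J (η ≫ θ) p).app D x =
      (extSystemMap J θ p).app D ((extSystemMap J η p).app D x) :=
  congr($(congr_app (extSystemMap_comp J η θ p) D) x)

/-- The inclusion of `ker π` factors through the larger kernel `ker (π ≫ w)`, which is acyclic. -/
lemma extSystemMap_kerFunctorι_eq_zero (π : E ⟶ H) (w : H ⟶ V)
    (hW : IsAcyclic J (kerFunctor (π ≫ w))) {D : (J ⥤ 𝒞)ᵒᵖ} {p : ℕ} (hp : 1 ≤ p)
    (x : (extSystem J (kerFunctor π) p).obj D) :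
    (extSystemMap J (kerFunctorι π) p).app D x = 0 := by
  have h : kerFunctorMap π (π ≫ w) (𝟙 E) w (Category.id_comp _) ≫ kerFunctorι (π ≫ w) =
    kerFunctorι π := rfl
  rw [← h, extSystemMap_comp_apply,
    hW.eq_zero hp (D := D) ((extSystemMap J (kerFunctorMap π _ _ w _) p).app D x), map_zero]

end

/-! ### The arrows not involving `C`, and their exactness -/

section Sequence

variable {R : Type u} [CommRing R] {G' G'' : Type u} [AddCommGroup G'] [Module R G']
  [AddCommGroup G''] [Module R G''] (β : G' →ₗ[R] G'') (J : Type u) [Preorder J]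

/-- The subfunctor `B_j` of boundaries of `coneZ β j`. -/
abbrev coneB (j : ℤ) : (CochainComplex (ModuleCat.{u} R) ℤ)ᵒᵖ ⥤ ModuleCat.{u} R :=
  kerFunctor (coneπ β j)

/-- The kernel `Q_j` of the morphism from `H̄_j` to `Hom(Z^j(-), G')`. -/
abbrev coneQ (j : ℤ) : (CochainComplex (ModuleCat.{u} R) ℤ)ᵒᵖ ⥤ ModuleCat.{u} R :=
  kerFunctor (barHToHomCocycles β j)

/-- The range `K_j` of the morphism from `H̄_j` to `Hom(Z^j(-), G')`. -/
abbrev coneK (j : ℤ) : (CochainComplex (ModuleCat.{u} R) ℤ)ᵒᵖ ⥤ ModuleCat.{u} R :=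
  rangeFunctor (barHToHomCocycles β j)

/-- The connecting homomorphism of `0 → B_j → Z_j → H̄_j → 0`. -/
def δH (j : ℤ) (p q : ℕ) (h : p + 1 = q) :
    extSystem J (barH β j) p ⟶ extSystem J (coneB β j) q :=
  extSystemδ J (kerShortComplex_shortExact (coneπ_surjective β j)) p q h

/-- The connecting homomorphism of `0 → Z_i → C_i → B_j → 0`, where `i = j + 1`. -/
def δB {i j : ℤ} (hij : j + 1 = i) (p q : ℕ) (h : p + 1 = q) :
    extSystem J (coneB β j) p ⟶ extSystem J (coneZ β i) q :=
  extSystemδ J (boundaryShortComplex_shortExact β hij) p q h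

/-- The connecting homomorphism of `0 → B_j → W_j → Q_j → 0`. -/
def δQ (j : ℤ) (p q : ℕ) (h : p + 1 = q) :
    extSystem J (coneQ β j) p ⟶ extSystem J (coneB β j) q :=
  extSystemδ J (kerKerShortComplex_shortExact (barHToHomCocycles β j) (coneπ_surjective β j)) p q h

/-- The morphism `Z_j → K_j`. -/
abbrev coneZToK (j : ℤ) : coneZ β j ⟶ coneK β j := coneπ β j ≫ toRangeFunctor (barHToHomCocycles β j)

variable {J} [IsDirectedOrder J] [Nonempty J] [Module.Injective R G'] [Module.Injective R G'']
  (D : (J ⥤ CochainComplex (ModuleCat.{u} R) ℤ)ᵒᵖ)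

lemma extSystemMap_coneB_eq_zero (j : ℤ) {p : ℕ} (hp : 1 ≤ p)
    (x : (extSystem J (coneB β j) p).obj D) :
    (extSystemMap J (kerFunctorι (coneπ β j)) p).app D x = 0 :=
  extSystemMap_kerFunctorι_eq_zero (coneπ β j) (barHToHomCocycles β j) (isAcyclic_coneW β j) hp x

lemma δH_surjective (j : ℤ) (p q : ℕ) (h : p + 1 = q) :
    Function.Surjective ((δH β J j p q h).app D) := fun x =>
  (extSystem_exact₁ (kerShortComplex_shortExact (coneπ_surjective β j)) D p q h x).1
    (extSystemMap_coneB_eq_zero β D j (by lia) x)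

lemma extSystemMap_coneπ_injective (j : ℤ) {p : ℕ} (hp : 1 ≤ p) :
    Function.Injective ((extSystemMap J (coneπ β j) p).app D) := by
  rw [injective_iff_map_eq_zero]
  intro x hx
  obtain ⟨y, rfl⟩ := (extSystem_exact₂ (kerShortComplex_shortExact (coneπ_surjective β j)) D p
    x).1 hx
  exact extSystemMap_coneB_eq_zero β D j hp y

lemma exact_coneπ_δH (j : ℤ) (p q : ℕ) (h : p + 1 = q) :
    Function.Exact ((extSystemMap J (coneπ β j) p).app D) ((δH β J j p q h).app D) :=
  extSystem_exact₃ (kerShortComplex_shortExact (coneπ_surjective β j)) D p q h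

lemma exact_coneB_coneπ (j : ℤ) (p : ℕ) :
    Function.Exact ((extSystemMap J (kerFunctorι (coneπ β j)) p).app D)
      ((extSystemMap J (coneπ β j) p).app D) :=
  extSystem_exact₂ (kerShortComplex_shortExact (coneπ_surjective β j)) D p

lemma exact_coneBoundary_δB {i j : ℤ} (hij : j + 1 = i) (p q : ℕ) (h : p + 1 = q) :
    Function.Exact ((extSystemMap J (coneBoundary β i j) p).app D)
      ((δB β J hij p q h).app D) :=
  extSystem_exact₃ (boundaryShortComplex_shortExact β hij) D p q h

lemma δB_surjective {i j : ℤ} (hij : j + 1 = i) (p q : ℕ) (h : p + 1 = q) :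
    Function.Surjective ((δB β J hij p q h).app D) :=
  extSystemδ_surjective (boundaryShortComplex_shortExact β hij) D (isAcyclic_coneX β i) p q h

lemma δB_bijective {i j : ℤ} (hij : j + 1 = i) {p q : ℕ} (h : p + 1 = q) (hp : 1 ≤ p) :
    Function.Bijective ((δB β J hij p q h).app D) :=
  extSystemδ_bijective (boundaryShortComplex_shortExact β hij) D (isAcyclic_coneX β i) p q h hp

lemma δQ_bijective (j : ℤ) {p q : ℕ} (h : p + 1 = q) (hp : 1 ≤ p) :
    Function.Bijective ((δQ β J j p q h).app D) :=
  extSystemδ_bijective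
    (kerKerShortComplex_shortExact (barHToHomCocycles β j) (coneπ_surjective β j)) D
    (isAcyclic_coneW β j) p q h hp

lemma coneZToK_surjective (j : ℤ) (p : ℕ) :
    Function.Surjective ((extSystemMap J (coneZToK β j) p).app D) :=
  extSystemMap_g_surjective
    (kerCompRangeShortComplex_shortExact (barHToHomCocycles β j) (coneπ_surjective β j)) D
    (isAcyclic_coneW β j) p

lemma coneZToK_bijective (j : ℤ) {p : ℕ} (hp : 1 ≤ p) :
    Function.Bijective ((extSystemMap J (coneZToK β j) p).app D) :=
  ⟨extSystemMap_g_injective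
    (kerCompRangeShortComplex_shortExact (barHToHomCocycles β j) (coneπ_surjective β j)) D
    (isAcyclic_coneW β j) p hp, coneZToK_surjective β D j p⟩

/-- The surjection `lim^(p) Z_j → lim^(p) K_j` factors through `lim^(p) H̄_j`. -/
lemma toConeK_surjective (j : ℤ) (p : ℕ) :
    Function.Surjective
      ((extSystemMap J (toRangeFunctor (barHToHomCocycles β j)) p).app D) := fun x => by
  obtain ⟨y, rfl⟩ := coneZToK_surjective β D j p x
  exact ⟨(extSystemMap J (coneπ β j) p).app D y,
    congr($(congr_app (extSystemMap_comp J (coneπ β j)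
      (toRangeFunctor (barHToHomCocycles β j)) p) D) y).symm⟩

lemma exact_coneQ_toConeK (j : ℤ) (p : ℕ) :
    Function.Exact ((extSystemMap J (kerFunctorι (barHToHomCocycles β j)) p).app D)
      ((extSystemMap J (toRangeFunctor (barHToHomCocycles β j)) p).app D) :=
  extSystem_exact₂ (kerRangeShortComplex_shortExact (barHToHomCocycles β j)) D p

/-- In degree `p - 1` the map to `K_j` is already surjective on derived limits, so the connecting
map into `lim^(p) Q_j` is zero. -/
lemma coneQ_injective (j : ℤ) {p : ℕ} (hp : 1 ≤ p) :
    Function.Injective ((extSystemMap J (kerFunctorι (barHToHomCocycles β j)) p).app D) := by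
  obtain ⟨p, rfl⟩ := Nat.exists_eq_add_of_le' hp
  have hS := kerRangeShortComplex_shortExact (barHToHomCocycles β j)
  rw [injective_iff_map_eq_zero]
  intro x hx
  obtain ⟨y, rfl⟩ := (extSystem_exact₁ hS D p (p + 1) rfl x).1 hx
  obtain ⟨z, rfl⟩ := toConeK_surjective β D j p y
  exact (extSystem_exact₃ hS D p (p + 1) rfl).apply_apply_eq_zero z

variable (J) in
/-- The arrows `lim^(p) H̄_j → lim^(p + 2) H̄_{j + 1}`. -/
def rightMap {i j : ℤ} (hij : j + 1 = i) {p q : ℕ} (h : p + 2 = q) :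
    extSystem J (barH β j) p ⟶ extSystem J (barH β i) q :=
  δH β J j p (p + 1) rfl ≫ δB β J hij (p + 1) q h ≫ extSystemMap J (coneπ β i) q

lemma rightMap_apply {i j : ℤ} (hij : j + 1 = i) {p q : ℕ} (h : p + 2 = q)
    (x : (extSystem J (barH β j) p).obj D) :
    (rightMap β J hij h).app D x = (extSystemMap J (coneπ β i) q).app D
      ((δB β J hij (p + 1) q h).app D ((δH β J j p (p + 1) rfl).app D x)) := rfl

/-- The last two factors of the arrow are injective since they act in degrees at least `1`; only the
kernel of `δH` remains. The case `p = 0` is included. -/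
lemma rightMap_eq_zero_iff {i j : ℤ} (hij : j + 1 = i) {p q : ℕ} (h : p + 2 = q)
    (x : (extSystem J (barH β j) p).obj D) :
    (rightMap β J hij h).app D x = 0 ↔ ∃ z, (extSystemMap J (coneπ β j) p).app D z = x := by
  rw [rightMap_apply, map_eq_zero_iff _ (extSystemMap_coneπ_injective β D i (by lia)),
    map_eq_zero_iff _ (δB_bijective β D hij h (by lia)).1]
  exact exact_coneπ_δH β D j p (p + 1) rfl x

/-- Kernel and image are both the image of `lim^(q) Z_i`, because `δH` and `δB` are surjective. -/
lemma exact_rightMap_rightMap {i j k : ℤ} (hij : j + 1 = i) (hki : i + 1 = k) {p q r : ℕ}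
    (h : p + 2 = q) (h' : q + 2 = r) :
    Function.Exact ((rightMap β J hij h).app D) ((rightMap β J hki h').app D) := by
  intro x
  rw [rightMap_eq_zero_iff]
  constructor
  · rintro ⟨z, rfl⟩
    obtain ⟨y, rfl⟩ := δB_surjective β D hij (p + 1) q h z
    obtain ⟨x, rfl⟩ := δH_surjective β D j p (p + 1) rfl y
    exact ⟨x, rfl⟩
  · rintro ⟨y, rfl⟩
    exact ⟨_, rfl⟩

variable (J) in
/-- The morphism `lim^(p) H̄_i → lim^(p) Z_i`, which factors over `lim^(p) K_i ≅ lim^(p) Z_i`. -/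
def toExtConeZ (i : ℤ) {p : ℕ} (hp : 1 ≤ p) : extSystem J (barH β i) p ⟶ extSystem J (coneZ β i) p :=
  extSystemMap J (toRangeFunctor (barHToHomCocycles β i)) p ≫
    natTransInv (extSystemMap J (coneZToK β i) p) (fun D => coneZToK_bijective β D i hp)

lemma toExtConeZ_surjective (i : ℤ) {p : ℕ} (hp : 1 ≤ p) :
    Function.Surjective ((toExtConeZ β J i hp).app D) :=
  (natTransInv_bijective _ _ D).2.comp (toConeK_surjective β D i p)

lemma toExtConeZ_eq_zero_iff (i : ℤ) {p : ℕ} (hp : 1 ≤ p) (x : (extSystem J (barH β i) p).obj D) :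
    (toExtConeZ β J i hp).app D x = 0 ↔
      ∃ y, (extSystemMap J (kerFunctorι (barHToHomCocycles β i)) p).app D y = x :=
  (map_eq_zero_iff _ (natTransInv_bijective _ _ D).1).trans (exact_coneQ_toConeK β D i p x)

variable (J) in
/-- The arrows `lim^(p + 2) H̄_{j + 1} → lim^(p) H̄_j`, where `1 ≤ p`. -/
def leftMap {i j : ℤ} (hij : j + 1 = i) {p q : ℕ} (h : p + 2 = q) (hp : 1 ≤ p) :
    extSystem J (barH β i) q ⟶ extSystem J (barH β j) p :=
  toExtConeZ β J i (by lia) ≫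
    natTransInv (δB β J hij (p + 1) q h) (fun D => δB_bijective β D hij h (by lia)) ≫
    natTransInv (δQ β J j p (p + 1) rfl) (fun D => δQ_bijective β D j rfl hp) ≫
    extSystemMap J (kerFunctorι (barHToHomCocycles β j)) p

lemma leftMap_eq_zero_iff {i j : ℤ} (hij : j + 1 = i) {p q : ℕ} (h : p + 2 = q) (hp : 1 ≤ p)
    (x : (extSystem J (barH β i) q).obj D) :
    (leftMap β J hij h hp).app D x = 0 ↔
      ∃ y, (extSystemMap J (kerFunctorι (barHToHomCocycles β i)) q).app D y = x :=
  (map_eq_zero_iff _ (coneQ_injective β D j hp)).trans <|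
    (map_eq_zero_iff _ (natTransInv_bijective _ _ D).1).trans <|
    (map_eq_zero_iff _ (natTransInv_bijective _ _ D).1).trans <|
    toExtConeZ_eq_zero_iff β D i (by lia) x

lemma exists_leftMap_eq_iff {i j : ℤ} (hij : j + 1 = i) {p q : ℕ} (h : p + 2 = q) (hp : 1 ≤ p)
    (x : (extSystem J (barH β j) p).obj D) :
    x ∈ Set.range ((leftMap β J hij h hp).app D) ↔
      ∃ y, (extSystemMap J (kerFunctorι (barHToHomCocycles β j)) p).app D y = x := by
  constructor
  · rintro ⟨y, rfl⟩
    exact ⟨_, rfl⟩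
  · rintro ⟨y, rfl⟩
    obtain ⟨y, rfl⟩ := (natTransInv_bijective (δQ β J j p (p + 1) rfl)
      (fun D => δQ_bijective β D j rfl hp) D).2 y
    obtain ⟨y, rfl⟩ := (natTransInv_bijective (δB β J hij (p + 1) q h)
      (fun D => δB_bijective β D hij h (by lia)) D).2 y
    obtain ⟨y, rfl⟩ := toExtConeZ_surjective β D i (by lia) y
    exact ⟨y, rfl⟩

/-- Kernel and image are both the image of `lim^(q) Q_i` in `lim^(q) H̄_i`. -/
lemma exact_leftMap_leftMap {i j k : ℤ} (hij : j + 1 = i) (hki : i + 1 = k) {p q r : ℕ}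
    (h : p + 2 = q) (h' : q + 2 = r) (hp : 1 ≤ p) :
    Function.Exact ((leftMap β J hki h' (by lia)).app D) ((leftMap β J hij h hp).app D) :=
  fun x => (leftMap_eq_zero_iff β D hij h hp x).trans
    (exists_leftMap_eq_iff β D hki h' (by lia) x).symm

end Sequence

/-! ### The arrows into and out of `H̄_j(C; G)` -/

section MiddleMap

variable {R : Type u} [CommRing R] {G' G'' : Type u} [AddCommGroup G'] [Module R G']
  [AddCommGroup G''] [Module R G''] (β : G' →ₗ[R] G'') {J : Type u} [Preorder J]
  [IsDirectedOrder J] [Nonempty J] [Module.Injective R G'] [Module.Injective R G'']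
  {D D' : J ⥤ CochainComplex (ModuleCat.{u} R) ℤ} {C C' : CochainComplex (ModuleCat.{u} R) ℤ}
  {φ : D ⟶ (Functor.const J).obj C} {φ' : D' ⟶ (Functor.const J).obj C'}
  (hφ : IsAssociated φ) (hφ' : IsAssociated φ') {i j : ℤ} (hij : j + 1 = i)

lemma coneToCycles_ext_zero (x : (extSystem J (coneX β i) 0).obj (op D)) :
    (extSystemMap J (kerFunctorι (coneπ β j)) 0).app (op D)
        ((extSystemMap J (coneBoundary β i j) 0).app (op D) x) =
      (extSystemMap J (coneToCycles β i j) 0).app (op D) x :=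
  congr($(congr_app (extSystemMap_comp J (coneBoundary β i j) (kerFunctorι (coneπ β j)) 0)
    (op D)) x).symm

lemma coneB_ext_zero {x y : (extSystem J (coneB β j) 0).obj (op D)}
    (h : (extSystemMap J (kerFunctorι (coneπ β j)) 0).app (op D) x =
      (extSystemMap J (kerFunctorι (coneπ β j)) 0).app (op D) y) : x = y :=
  ext_zero_ext fun a => Subtype.ext <|
    (extEval_extSystemMap (kerFunctorι (coneπ β j)) a x).symm.trans
      ((congrArg _ h).trans (extEval_extSystemMap (kerFunctorι (coneπ β j)) a y))

include hφ in
lemma IsAssociated.comparison_eq_zero_of_δB (b : (extSystem J (coneB β j) 0).obj (op D))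
    (hb : (δB β J hij 0 1 rfl).app (op D) b = 0) :
    hφ.comparison β hij ((extSystemMap J (kerFunctorι (coneπ β j)) 0).app (op D) b) = 0 := by
  obtain ⟨x, rfl⟩ := (exact_coneBoundary_δB β (op D) hij 0 1 rfl b).1 hb
  rw [coneToCycles_ext_zero, hφ.comparison_coneToCycles]

/-- The injection `lim^(1) Z_{j + 1} → H̄_j(C; G)`. -/
def IsAssociated.fromExtConeZ : (extSystem J (coneZ β i) 1).obj (op D) ⟶ (barH β j).obj (op C) :=
  surjDesc ((δB β J hij 0 1 rfl).app (op D)) (δB_surjective β (op D) hij 0 1 rfl)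
    ((extSystemMap J (kerFunctorι (coneπ β j)) 0).app (op D) ≫ hφ.comparison β hij)
    (hφ.comparison_eq_zero_of_δB β hij)

lemma IsAssociated.fromExtConeZ_apply (b : (extSystem J (coneB β j) 0).obj (op D)) :
    hφ.fromExtConeZ β hij ((δB β J hij 0 1 rfl).app (op D) b) =
      hφ.comparison β hij ((extSystemMap J (kerFunctorι (coneπ β j)) 0).app (op D) b) :=
  surjDesc_apply _ _ _ _ _

/-- The kernel of the comparison map consists of boundaries of compatible families of chains. A
family of boundaries lying in it therefore lifts to `lim C_i`, and `δB` kills it. -/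
lemma IsAssociated.fromExtConeZ_injective : Function.Injective (hφ.fromExtConeZ β hij) := by
  rw [injective_iff_map_eq_zero]
  intro z hz
  obtain ⟨b, rfl⟩ := δB_surjective β (op D) hij 0 1 rfl z
  rw [hφ.fromExtConeZ_apply] at hz
  obtain ⟨x, hx⟩ := hφ.exists_coneToCycles_eq β hij _ hz
  rw [← coneToCycles_ext_zero] at hx
  obtain rfl := coneB_ext_zero β hx
  exact (exact_coneBoundary_δB β (op D) hij 0 1 rfl).apply_apply_eq_zero x

/-- After lifting to `lim Z_j` along the comparison map, the kernel of `lim Z_j → lim H̄_j` is `lim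
B_j`. -/
lemma IsAssociated.exact_fromExtConeZ :
    Function.Exact (hφ.fromExtConeZ β hij) (toExtSystem (barH β j) φ) := by
  intro y
  constructor
  · intro hy
    obtain ⟨z, rfl⟩ := hφ.comparison_surjective β hij y
    rw [hφ.toExtSystem_comparison] at hy
    obtain ⟨b, rfl⟩ := (exact_coneB_coneπ β (op D) j 0 z).1 hy
    exact ⟨_, hφ.fromExtConeZ_apply β hij b⟩
  · rintro ⟨z, rfl⟩
    obtain ⟨b, rfl⟩ := δB_surjective β (op D) hij 0 1 rfl z
    rw [hφ.fromExtConeZ_apply, hφ.toExtSystem_comparison]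
    exact (exact_coneB_coneπ β (op D) j 0).apply_apply_eq_zero b

lemma IsAssociated.fromExtConeZ_naturality (f : D ⟶ D') (g : C ⟶ C')
    (h : φ ≫ (Functor.const J).map g = f ≫ φ') (z : (extSystem J (coneZ β i) 1).obj (op D')) :
    hφ.fromExtConeZ β hij ((extSystem J (coneZ β i) 1).map f.op z) =
      (barH β j).map g.op (hφ'.fromExtConeZ β hij z) := by
  obtain ⟨b, rfl⟩ := δB_surjective β (op D') hij 0 1 rfl z
  have h₁ := natTrans_naturality_apply (δB β J hij 0 1 rfl) f.op b
  have h₂ := natTrans_naturality_apply (extSystemMap J (kerFunctorι (coneπ β j)) 0) f.op b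
  rw [← h₁, hφ.fromExtConeZ_apply, hφ'.fromExtConeZ_apply, h₂,
    hφ.comparison_naturality β hφ' hij f g h]

/-- The arrow `lim^(1) H̄_{j + 1} → H̄_j(C; G)`. -/
def IsAssociated.middleMap : (extSystem J (barH β i) 1).obj (op D) ⟶ (barH β j).obj (op C) :=
  (toExtConeZ β J i le_rfl).app (op D) ≫ hφ.fromExtConeZ β hij

lemma IsAssociated.middleMap_naturality (f : D ⟶ D') (g : C ⟶ C')
    (h : φ ≫ (Functor.const J).map g = f ≫ φ') :
    (extSystem J (barH β i) 1).map f.op ≫ hφ.middleMap β hij =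
      hφ'.middleMap β hij ≫ (barH β j).map g.op := by
  ext x
  refine (congrArg (hφ.fromExtConeZ β hij)
    (natTrans_naturality_apply (toExtConeZ β J i le_rfl) f.op x)).trans ?_
  exact hφ.fromExtConeZ_naturality β hφ' hij f g h _

lemma IsAssociated.exact_leftMap_middleMap {k : ℤ} (hki : i + 1 = k) :
    Function.Exact ((leftMap β J hki (show 1 + 2 = 3 from rfl) le_rfl).app (op D))
      (hφ.middleMap β hij) := fun x =>
  ((map_eq_zero_iff _ (hφ.fromExtConeZ_injective β hij)).trans
    (toExtConeZ_eq_zero_iff β (op D) i le_rfl x)).trans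
    (exists_leftMap_eq_iff β (op D) hki _ le_rfl x).symm

lemma IsAssociated.exact_middleMap_toExtSystem :
    Function.Exact (hφ.middleMap β hij) (toExtSystem (barH β j) φ) := fun x => by
  refine (hφ.exact_fromExtConeZ β hij x).trans ?_
  constructor
  · rintro ⟨y, rfl⟩
    obtain ⟨y, rfl⟩ := toExtConeZ_surjective β (op D) i le_rfl y
    exact ⟨y, rfl⟩
  · rintro ⟨y, rfl⟩
    exact ⟨_, rfl⟩

-- The comparison map is surjective, so the image of `H̄_j(C; G)` in `lim H̄_j` equals that of `lim
-- Z_j`, which is the kernel of the next arrow.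
include hφ in
lemma IsAssociated.exact_toExtSystem_rightMap :
    Function.Exact (toExtSystem (barH β j) φ)
      ((rightMap β J hij (show 0 + 2 = 2 from rfl)).app (op D)) := fun x => by
  rw [rightMap_eq_zero_iff]
  constructor
  · rintro ⟨z, rfl⟩
    exact ⟨_, hφ.toExtSystem_comparison β hij z⟩
  · rintro ⟨y, rfl⟩
    obtain ⟨z, rfl⟩ := hφ.comparison_surjective β hij y
    exact ⟨z, (hφ.toExtSystem_comparison β hij z).symm⟩

end MiddleMap

/-! ### Transport from `Ext` back to derived limits -/

section Transport

variable {R : Type u} [CommRing R]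

lemma exact_of_comm {A B C A' B' C' : ModuleCat.{u} R} {f : A ⟶ B} {g : B ⟶ C} {f' : A' ⟶ B'}
    {g' : B' ⟶ C'} (a : A' ≅ A) (b : B' ≅ B) (c : C' ≅ C) (hf : f' ≫ b.hom = a.hom ≫ f)
    (hg : g' ≫ c.hom = b.hom ≫ g) (h : Function.Exact f g) : Function.Exact f' g' := by
  have hf' : f' = a.hom ≫ f ≫ b.inv := by rw [← Category.assoc, ← hf]; simp
  have hg' : g' = b.hom ≫ g ≫ c.inv := by rw [← Category.assoc, ← hg]; simp
  subst hf' hg'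
  intro y
  have hc : Function.Injective c.inv :=
    ((ConcreteCategory.isIso_iff_bijective c.inv).1 inferInstance).1
  refine (map_eq_zero_iff (c.inv).hom hc).trans ((h (b.hom y)).trans ?_)
  constructor
  · rintro ⟨x, hx⟩
    refine ⟨a.inv x, ?_⟩
    have h₁ : a.hom (a.inv x) = x := congr($(a.inv_hom_id) x)
    have h₂ : b.inv (b.hom y) = y := congr($(b.hom_inv_id) y)
    refine (congrArg (fun t => b.inv (f t)) h₁).trans ((congrArg b.inv hx).trans h₂)
  · rintro ⟨x, rfl⟩
    refine ⟨a.hom x, ?_⟩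
    exact congr($(b.inv_hom_id) (f (a.hom x))).symm

variable {G' G'' : Type u} [AddCommGroup G'] [Module R G']
  [AddCommGroup G''] [Module R G''] (β : G' →ₗ[R] G'') (J : Type u) [Preorder J]

/-- The derived limits of `H̄_j` in terms of extensions. -/
def derivedLimBarHIso (p : ℕ) (j : ℤ) : derivedLimBarH J β p j ≅ extSystem J (barH β j) p :=
  Functor.isoWhiskerLeft (barHSystem J β j) (rightDerivedLimIso R Jᵒᵖ p)

/-- The limit of `H̄_j` in terms of extensions. -/
def limBarHIso (j : ℤ) : limBarH J β j ≅ extSystem J (barH β j) 0 :=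
  limSystemIso J (barH β j)

variable {J}

lemma toLimBarH_limBarHIso (j : ℤ) {D : J ⥤ CochainComplex (ModuleCat.{u} R) ℤ}
    {C : CochainComplex (ModuleCat.{u} R) ℤ} (φ : D ⟶ (Functor.const J).obj C) :
    toLimBarH β j φ ≫ ((limBarHIso β J j).app (op D)).hom = toExtSystem (barH β j) φ := rfl

lemma conj_comm {𝒞 : Type*} [Category 𝒞] {E F E' F' : 𝒞 ⥤ ModuleCat.{u} R} (a : E' ≅ E)
    (b : F' ≅ F) (η : E ⟶ F) (D : 𝒞) :
    (a.hom ≫ η ≫ b.inv).app D ≫ (b.app D).hom = (a.app D).hom ≫ η.app D := by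
  simp

end Transport

end BarHomology

end

theorem lemma5 {R : Type u} [CommRing R] [IsDomain R] [IsPrincipalIdealRing R]
    {G G' G'' : Type u} [AddCommGroup G] [Module R G] [AddCommGroup G'] [Module R G']
    [AddCommGroup G''] [Module R G''] [Module.Injective R G'] [Module.Injective R G'']
    (α : G →ₗ[R] G') (β : G' →ₗ[R] G'') (hα : Function.Injective α)
    (hαβ : Function.Exact α β) (hβ : Function.Surjective β)
    (J : Type u) [Preorder J] [IsDirectedOrder J] [Nonempty J] (n : ℤ) :
    -- the arrows of the sequence, natural in the direct system
    ∃ (l : ∀ k : ℕ, BarHomology.derivedLimBarH J β (2 * (k + 1) + 1) (n + (k + 1 + 1 : ℕ)) ⟶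
            BarHomology.derivedLimBarH J β (2 * k + 1) (n + (k + 1 : ℕ)))
      (ι : ∀ {D : J ⥤ CochainComplex (ModuleCat.{u} R) ℤ}
            {C : CochainComplex (ModuleCat.{u} R) ℤ} (φ : D ⟶ (Functor.const J).obj C),
            BarHomology.IsAssociated φ →
            ((BarHomology.derivedLimBarH J β 1 (n + (0 + 1 : ℕ))).obj (op D) ⟶
              (BarHomology.barH β n).obj (op C)))
      (η : BarHomology.limBarH J β n ⟶ BarHomology.derivedLimBarH J β 2 (n + (0 + 1 : ℕ)))
      (r : ∀ k : ℕ, BarHomology.derivedLimBarH J β (2 * (k + 1)) (n + (k + 1 : ℕ)) ⟶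
            BarHomology.derivedLimBarH J β (2 * (k + 1 + 1)) (n + (k + 1 + 1 : ℕ))),
      -- `ι` is natural with respect to morphisms of direct systems with a target complex
      (∀ {D D' : J ⥤ CochainComplex (ModuleCat.{u} R) ℤ}
          {C C' : CochainComplex (ModuleCat.{u} R) ℤ}
          (φ : D ⟶ (Functor.const J).obj C) (φ' : D' ⟶ (Functor.const J).obj C')
          (hφ : BarHomology.IsAssociated φ) (hφ' : BarHomology.IsAssociated φ')
          (f : D ⟶ D') (g : C ⟶ C'), φ ≫ (Functor.const J).map g = f ≫ φ' →
          (BarHomology.derivedLimBarH J β 1 (n + (0 + 1 : ℕ))).map f.op ≫ ι φ hφ =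
            ι φ' hφ' ≫ (BarHomology.barH β n).map g.op) ∧
      -- exactness, for every direct system `D` associated with a cochain complex `C`
      ∀ {D : J ⥤ CochainComplex (ModuleCat.{u} R) ℤ}
        {C : CochainComplex (ModuleCat.{u} R) ℤ} (φ : D ⟶ (Functor.const J).obj C)
        (hφ : BarHomology.IsAssociated φ),
        (∀ k : ℕ, Function.Exact ((l (k + 1)).app (op D)) ((l k).app (op D))) ∧
        Function.Exact ((l 0).app (op D)) (ι φ hφ) ∧
        Function.Exact (ι φ hφ) (BarHomology.toLimBarH β n φ) ∧
        Function.Exact (BarHomology.toLimBarH β n φ) (η.app (op D)) ∧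
        Function.Exact (η.app (op D)) ((r 0).app (op D)) ∧
        (∀ k : ℕ, Function.Exact ((r k).app (op D)) ((r (k + 1)).app (op D))) := by
  open BarHomology in
  have hk (k : ℕ) : n + (k + 1 : ℕ) + 1 = n + (k + 1 + 1 : ℕ) := by push_cast; ring
  have h₀ : n + 1 = n + (0 + 1 : ℕ) := by simp
  let e (p : ℕ) (j : ℤ) := derivedLimBarHIso β J p j
  let e₀ := limBarHIso β J n
  -- Each arrow is its `Ext` version conjugated by the identification of derived limits; `H̄_n(C;
  -- G)` itself is left unchanged.
  refine ⟨fun k => (e _ _).hom ≫ leftMap β J (hk k) (by lia) (by lia) ≫ (e _ _).inv,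
    fun {D C} φ hφ => (e _ _).hom.app (op D) ≫ hφ.middleMap β h₀,
    e₀.hom ≫ rightMap β J h₀ rfl ≫ (e _ _).inv,
    fun k => (e _ _).hom ≫ rightMap β J (hk k) (by lia) ≫ (e _ _).inv, ?_, ?_⟩
  · intro D D' C C' φ φ' hφ hφ' f g h
    rw [← Category.assoc, (e _ _).hom.naturality, Category.assoc, Category.assoc,
      hφ.middleMap_naturality β hφ' h₀ f g h]
  · intro D C φ hφ
    have hι : ((e 1 (n + (0 + 1 : ℕ))).hom.app (op D) ≫ hφ.middleMap β h₀) ≫ (Iso.refl _).hom =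
        ((e 1 _).app (op D)).hom ≫ hφ.middleMap β h₀ := Category.comp_id _
    have ht : toLimBarH β n φ ≫ (e₀.app (op D)).hom =
        (Iso.refl _).hom ≫ toExtSystem (barH β n) φ :=
      (toLimBarH_limBarHIso β n φ).trans (Category.id_comp _).symm
    refine ⟨fun k => ?_, ?_, ?_, ?_, ?_, fun k => ?_⟩
    · exact exact_of_comm ((e _ _).app _) ((e _ _).app _) ((e _ _).app _) (conj_comm _ _ _ _)
        (conj_comm _ _ _ _) (exact_leftMap_leftMap β (op D) (hk k) (hk (k + 1)) _ _ _)
    · exact exact_of_comm ((e _ _).app _) ((e _ _).app _) (Iso.refl _) (conj_comm _ _ _ _)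
        hι (hφ.exact_leftMap_middleMap β h₀ (hk 0))
    · exact exact_of_comm ((e _ _).app _) (Iso.refl _) (e₀.app _) hι ht
        (hφ.exact_middleMap_toExtSystem β h₀)
    · exact exact_of_comm (Iso.refl _) (e₀.app _) ((e _ _).app _) ht (conj_comm _ _ _ _)
        (hφ.exact_toExtSystem_rightMap β h₀)
    · exact exact_of_comm (e₀.app _) ((e _ _).app _) ((e _ _).app _) (conj_comm _ _ _ _)
        (conj_comm _ _ _ _) (exact_rightMap_rightMap β (op D) h₀ (hk 0) _ _)
    · exact exact_of_comm ((e _ _).app _) ((e _ _).app _) ((e _ _).app _) (conj_comm _ _ _ _)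
        (conj_comm _ _ _ _) (exact_rightMap_rightMap β (op D) (hk k) (hk (k + 1)) _ _)
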